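/- Let $R$ be an integral domain containing the field $\mathbb{Q}$ and satisfying the ascending chain condition on radical ideals, and let $m$ be a natural number. Let $P_m$ be the symplectic Poisson algebra of index $m$ over $R$, that is, the polynomial algebra $R[x_1,\dots,x_{2m}]$ with its $R$-module structure, its usual product and the bracket $$\{f,g\}=\sum_{i=1}^m\Bigl(\frac{\partial f}{\partial x_{2i-1}}\frac{\partial g}{\partial x_{2i}}-\frac{\partial f}{\partial x_{2i}}\frac{\partial g}{\partial x_{2i-1}}\Bigr).$$ Let $\mathfrak{M}=\mathrm{Var}(P_m)$ be the variety generated by $P_m$, that is, the class of all algebras (with the operations of an $R$-module, a product and a bracket) that satisfy all identities of $P_m$. Then every free algebra $F$ of $\mathfrak{M}$, on any set of free generators, finite or infinite, is equationally Noetherian: for every natural number $n$, the set $F^n$ is a Noetherian topological space in the Zariski topology. Here the Zariski topology is the coarsest topology in which the sets $$Z(S)=\{(a_1,\dots,a_n)\in F^n \mid f(a_1,\dots,a_n)=0\ \text{for all } f\in S\}$$ are closed for all subsets $S$ of the coproduct $F\sqcup_{\mathfrak{M}}\mathfrak{M}\langle x_1,\dots,x_n\rangle$ in $\mathfrak{M}$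 of $F$ and the free algebra on $x_1,\dots,x_n$, and $f(a_1,\dots,a_n)$ is the image of $f$ under the homomorphism to $F$ that is the identity on $F$ and sends each $x_i$ to $a_i$. The same holds when the identity element is added to the operations, as a constant. -/

import Mathlib

universe u v w w'

namespace UnivAlg

open scoped FirstOrder
open FirstOrder.Language

section General

/-! ### Universal algebra: identities, varieties, free algebras, coproducts

A signature of universal algebras is a first-order language without relation symbols; an algebra of
that signature is a structure for this language. -/

variable {L : FirstOrder.Language.{u, 0}}

/-- An identity `s = t`, in variables indexed by `ℕ`. -/
abbrev Identity (L : FirstOrder.Language.{u, 0}) : Type u := L.Term ℕ × L.Term ℕ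

/-- The identity `e` holds in the algebra `A`. -/
def Holds (A : Type w) [L.Structure A] (e : Identity L) : Prop :=
  ∀ x : ℕ → A, e.1.realize x = e.2.realize x

/-- A variety is the class of all algebras that satisfy a given set `E` of identities.
`InVariety E A` says that `A` belongs to the variety defined by `E`. -/
def InVariety (E : Set (Identity L)) (A : Type w) [L.Structure A] : Prop :=
  ∀ e ∈ E, Holds A e

/-- The set of all identities of `A`. It defines the variety `Var(A)` generated by `A`. -/
def identitiesOf (L : FirstOrder.Language.{u, 0}) (A : Type w) [L.Structure A] : Set (Identity L) :=
  {e | Holds A e}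

/-- `F` is a free algebra of the variety defined by `E`, freely generated by the family `ι`. -/
structure IsFree (E : Set (Identity L)) {X : Type v} {F : Type w} [L.Structure F]
    (ι : X → F) : Prop where
  inVariety : InVariety E F
  existsUnique_hom : ∀ (B : Type w) [L.Structure B], InVariety E B → ∀ b : X → B,
    ∃! φ : F →[L] B, ∀ x, φ (ι x) = b x

/-- The congruence on the algebra of terms in the variables `Y` that is generated by a relation `r`
and by all substitution instances of the identities in `E`. -/
inductive Cong (E : Set (Identity L)) {Y : Type v} (r : L.Term Y → L.Term Y → Prop) :
    L.Term Y → L.Term Y → Prop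
  | of {s t} : r s t → Cong E r s t
  | ident {e : Identity L} (he : e ∈ E) (σ : ℕ → L.Term Y) :
      Cong E r (e.1.subst σ) (e.2.subst σ)
  | refl (t) : Cong E r t t
  | symm {s t} : Cong E r s t → Cong E r t s
  | trans {s t q} : Cong E r s t → Cong E r t q → Cong E r s q
  | func {k : ℕ} (f : L.Functions k) {ts ss : Fin k → L.Term Y} :
      (∀ i, Cong E r (ts i) (ss i)) → Cong E r (Term.func f ts) (Term.func f ss)

/-- The congruence above, as a setoid. -/
def congSetoid (E : Set (Identity L)) {Y : Type v} (r : L.Term Y → L.Term Y → Prop) :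
    Setoid (L.Term Y) :=
  ⟨Cong E r, ⟨Cong.refl, Cong.symm, Cong.trans⟩⟩

/-- The algebra with generators `Y` and defining relations `r` in the variety defined by `E`. -/
def Presented (E : Set (Identity L)) {Y : Type v} (r : L.Term Y → L.Term Y → Prop) :
    Type (max u v) :=
  Quotient (congSetoid E r)

namespace Presented

variable {E : Set (Identity L)} {Y : Type v} {r : L.Term Y → L.Term Y → Prop}

/-- The class of a term. -/
def mk (E : Set (Identity L)) (r : L.Term Y → L.Term Y → Prop) (t : L.Term Y) : Presented E r :=
  Quotient.mk (congSetoid E r) t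

theorem mk_eq_mk {s t : L.Term Y} : mk E r s = mk E r t ↔ Cong E r s t :=
  ⟨fun h => Quotient.exact (s := congSetoid E r) h,
    fun h => Quotient.sound (s := congSetoid E r) h⟩

theorem realize_eq_of_cong {C : Type w} [L.Structure C] (hC : InVariety E C) (c : Y → C)
    (hr : ∀ s t, r s t → s.realize c = t.realize c) {s t : L.Term Y} (h : Cong E r s t) :
    s.realize c = t.realize c := by
  induction h with
  | of h => exact hr _ _ h
  | ident he σ =>
    simp only [Term.realize_subst]
    exact hC _ he _
  | refl => rfl
  | symm _ ih => exact ih.symm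
  | trans _ _ ih₁ ih₂ => exact ih₁.trans ih₂
  | func f _ ih => simp only [Term.realize, ih]

noncomputable instance [L.IsAlgebraic] : L.Structure (Presented E r) where
  funMap f xs := mk E r (Term.func f fun i => Quotient.out (xs i))
  RelMap ρ := isEmptyElim ρ

theorem mk_out (x : Presented E r) : mk E r (Quotient.out x) = x :=
  Quotient.out_eq x

variable [L.IsAlgebraic]

theorem funMap_mk {k : ℕ} (f : L.Functions k) (ts : Fin k → L.Term Y) :
    Structure.funMap f (fun i => mk E r (ts i)) = mk E r (Term.func f ts) :=
  mk_eq_mk.2 (Cong.func f fun i => mk_eq_mk.1 (mk_out (mk E r (ts i))))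

theorem realize_mk {Z : Type w} (t : L.Term Z) (σ : Z → L.Term Y) :
    t.realize (fun z => mk E r (σ z)) = mk E r (t.subst σ) := by
  induction t with
  | var z => rfl
  | func f ts ih => simp only [Term.realize, Term.subst, ih, funMap_mk]

theorem inVariety : InVariety E (Presented E r) := by
  intro e he x
  have hx : x = fun i => mk E r (Quotient.out (x i)) := funext fun i => (mk_out (x i)).symm
  rw [hx, realize_mk, realize_mk]
  exact mk_eq_mk.2 (Cong.ident he _)

/-- The homomorphism to an algebra `C` of the variety that is given by a family of elements of `C`
satisfying the defining relations. -/
def lift {C : Type w} [L.Structure C] (hC : InVariety E C) (c : Y → C)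
    (hr : ∀ s t, r s t → s.realize c = t.realize c) : Presented E r →[L] C where
  toFun := Quotient.lift (fun t : L.Term Y => t.realize c)
    fun _ _ h => realize_eq_of_cong hC c hr h
  map_fun' f xs := by
    have hx : xs = fun i => mk E r (Quotient.out (xs i)) := funext fun i => (mk_out (xs i)).symm
    rw [hx, funMap_mk]
    rfl
  map_rel' ρ := isEmptyElim ρ

theorem lift_mk {C : Type w} [L.Structure C] (hC : InVariety E C) (c : Y → C)
    (hr : ∀ s t, r s t → s.realize c = t.realize c) (t : L.Term Y) :
    lift hC c hr (mk E r t) = t.realize c := rfl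

theorem hom_ext {C : Type w} [L.Structure C] {φ ψ : Presented E r →[L] C}
    (h : ∀ y, φ (mk E r (Term.var y)) = ψ (mk E r (Term.var y))) : φ = ψ := by
  ext x
  obtain ⟨t, rfl⟩ := Quotient.exists_rep (s := congSetoid E r) x
  change φ (mk E r t) = ψ (mk E r t)
  induction t with
  | var y => exact h y
  | func f ts ih => rw [← funMap_mk, Hom.map_fun, Hom.map_fun]; congr 1; funext i; exact ih i

end Presented

variable [L.IsAlgebraic]

/-- The free algebra `𝔐⟨X⟩` of the variety `𝔐` defined by `E`: terms modulo the identities. -/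
abbrev FreeAlg (E : Set (Identity L)) (X : Type v) : Type (max u v) :=
  Presented E (fun _ _ : L.Term X => False)

/-- The free generators. -/
def FreeAlg.gen (E : Set (Identity L)) {X : Type v} (x : X) : FreeAlg E X :=
  Presented.mk E _ (Term.var x)

/-- The homomorphism from the free algebra given by the images of the generators. -/
def FreeAlg.lift {E : Set (Identity L)} {X : Type v} {C : Type w} [L.Structure C]
    (hC : InVariety E C) (c : X → C) : FreeAlg E X →[L] C :=
  Presented.lift hC c fun _ _ h => h.elim

theorem FreeAlg.isFree (E : Set (Identity L)) (X : Type v) :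
    IsFree E (FreeAlg.gen E : X → FreeAlg E X) where
  inVariety := Presented.inVariety
  existsUnique_hom _ _ hB b :=
    ⟨FreeAlg.lift hB b, fun _ => rfl, fun _ h => Presented.hom_ext h⟩

/-- The operation tables of `A` and `G`, as relations between terms in the elements of `A` and of
`G`. -/
inductive Table (L : FirstOrder.Language.{u, 0}) (A : Type w) (G : Type w') [L.Structure A] [L.Structure G] :
    L.Term (A ⊕ G) → L.Term (A ⊕ G) → Prop
  | left {k : ℕ} (f : L.Functions k) (a : Fin k → A) :
      Table L A G (Term.func f fun i => Term.var (Sum.inl (a i)))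
        (Term.var (Sum.inl (Structure.funMap f a)))
  | right {k : ℕ} (f : L.Functions k) (g : Fin k → G) :
      Table L A G (Term.func f fun i => Term.var (Sum.inr (g i)))
        (Term.var (Sum.inr (Structure.funMap f g)))

/-- The coproduct (free product) of `A` and `G` in the variety defined by `E`. -/
abbrev Coprod (E : Set (Identity L)) (A : Type w) (G : Type w') [L.Structure A] [L.Structure G] :
    Type (max u w w') :=
  Presented E (Table L A G)

namespace Coprod

variable {E : Set (Identity L)} {A : Type w} {G : Type w'} [L.Structure A] [L.Structure G]

/-- The canonical homomorphism from the first algebra to the coproduct. -/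
def inl : A →[L] Coprod E A G where
  toFun a := Presented.mk E _ (Term.var (Sum.inl a))
  map_fun' f a :=
    ((Presented.funMap_mk f _).trans (Presented.mk_eq_mk.2 (Cong.of (Table.left f a)))).symm
  map_rel' ρ := isEmptyElim ρ

/-- The canonical homomorphism from the second algebra to the coproduct. -/
def inr : G →[L] Coprod E A G where
  toFun g := Presented.mk E _ (Term.var (Sum.inr g))
  map_fun' f g :=
    ((Presented.funMap_mk f _).trans (Presented.mk_eq_mk.2 (Cong.of (Table.right f g)))).symm
  map_rel' ρ := isEmptyElim ρ

/-- The homomorphism from the coproduct given by homomorphisms from the two algebras. -/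
def desc {C : Type v} [L.Structure C] (hC : InVariety E C) (φ₁ : A →[L] C) (φ₂ : G →[L] C) :
    Coprod E A G →[L] C :=
  Presented.lift hC (Sum.elim φ₁ φ₂) fun s t h => by
    cases h with
    | left f a => exact (φ₁.map_fun f a).symm
    | right f g => exact (φ₂.map_fun f g).symm

/-- The universal property of the coproduct. -/
theorem existsUnique_hom {C : Type v} [L.Structure C] (hC : InVariety E C)
    (φ₁ : A →[L] C) (φ₂ : G →[L] C) :
    ∃! φ : Coprod E A G →[L] C, φ.comp inl = φ₁ ∧ φ.comp inr = φ₂ := by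
  refine ⟨desc hC φ₁ φ₂, ⟨rfl, rfl⟩, ?_⟩
  rintro ψ ⟨rfl, rfl⟩
  refine Presented.hom_ext fun y => ?_
  cases y <;> rfl

end Coprod

/-! ### Algebraic geometry over an algebra -/

variable {E : Set (Identity L)} {A : Type w} [L.Structure A]

/-- The value `f(a₁, …, aₙ)` of `f ∈ A ⊔ 𝔐⟨x₁, …, xₙ⟩`: the image of `f` under the homomorphism to
`A` that is the identity on `A` and sends each `xᵢ` to `aᵢ`. -/
noncomputable def eval (hA : InVariety E A) {n : ℕ} (f : Coprod E A (FreeAlg E (Fin n))) (a : Fin n → A) : A :=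
  Coprod.desc hA (Hom.id L A) (FreeAlg.lift hA a) f

/-- The set `Z(S) ⊆ Aⁿ` of zeroes of `S`, where the constant symbol `z` denotes zero. -/
def zeroes (z : L.Constants) (hA : InVariety E A) {n : ℕ}
    (S : Set (Coprod E A (FreeAlg E (Fin n)))) : Set (Fin n → A) :=
  {a | ∀ f ∈ S, eval hA f a = (z : A)}

/-- The Zariski topology on `Aⁿ`: the coarsest topology in which all the sets `Z(S)` are closed. -/
@[reducible]
def zariskiTopology (z : L.Constants) (hA : InVariety E A) (n : ℕ) :
    TopologicalSpace (Fin n → A) :=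
  TopologicalSpace.generateFrom {U | ∃ S, U = (zeroes z hA (n := n) S)ᶜ}

/-- The algebra `A` of the variety defined by `E` is equationally Noetherian. -/
def EquationallyNoetherian (z : L.Constants) (hA : InVariety E A) : Prop :=
  ∀ n : ℕ, @TopologicalSpace.NoetherianSpace (Fin n → A) (zariskiTopology z hA n)

end General

/-! ### The symplectic Poisson algebra -/

/-- The operations of Poisson algebras over `R`, by arity: those of an `R`-module, the product and
the bracket; the identity element is included if and only if the Boolean is `true`. -/
inductive PoissonOp (R : Type u) : Bool → ℕ → Type u
  | zero {b} : PoissonOp R b 0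
  | one : PoissonOp R true 0
  | neg {b} : PoissonOp R b 1
  | smul {b} (r : R) : PoissonOp R b 1
  | add {b} : PoissonOp R b 2
  | mul {b} : PoissonOp R b 2
  | bracket {b} : PoissonOp R b 2

/-- The signature of Poisson algebras over `R`, without (`false`) or with (`true`) identity. -/
def poissonLang (R : Type u) (b : Bool) : FirstOrder.Language.{u, 0} where
  Functions := PoissonOp R b
  Relations _ := Empty

instance (R : Type u) (b : Bool) : (poissonLang R b).IsAlgebraic :=
  fun _ => inferInstanceAs (IsEmpty Empty)

/-- The bracket `∑ᵢ (∂f/∂x₂ᵢ₋₁ ∂g/∂x₂ᵢ - ∂f/∂x₂ᵢ ∂g/∂x₂ᵢ₋₁)` on `R[x₁, …, x₂ₘ]`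
(the variables are numbered from `0` here). -/
noncomputable def symplecticBracket {R : Type u} [CommRing R] {m : ℕ}
    (f g : MvPolynomial (Fin (2 * m)) R) : MvPolynomial (Fin (2 * m)) R :=
  ∑ i : Fin m,
    (MvPolynomial.pderiv ⟨2 * i.1, by omega⟩ f * MvPolynomial.pderiv ⟨2 * i.1 + 1, by omega⟩ g -
      MvPolynomial.pderiv ⟨2 * i.1 + 1, by omega⟩ f * MvPolynomial.pderiv ⟨2 * i.1, by omega⟩ g)

/-- The underlying set of the symplectic Poisson algebra `Pₘ` over `R`. -/
def SymplecticPoisson (R : Type u) [CommRing R] (m : ℕ) : Type u :=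
  MvPolynomial (Fin (2 * m)) R

/-- The operations of `Pₘ`. -/
noncomputable def SymplecticPoisson.op {R : Type u} [CommRing R] {m : ℕ} :
    {b : Bool} → {k : ℕ} → PoissonOp R b k →
      (Fin k → MvPolynomial (Fin (2 * m)) R) → MvPolynomial (Fin (2 * m)) R
  | _, _, .zero, _ => 0
  | _, _, .one, _ => 1
  | _, _, .neg, x => -x 0
  | _, _, .smul r, x => r • x 0
  | _, _, .add, x => x 0 + x 1
  | _, _, .mul, x => x 0 * x 1
  | _, _, .bracket, x => symplecticBracket (x 0) (x 1)

/-- The symplectic Poisson algebra `Pₘ` as an algebra of the signature of Poisson algebras. -/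
noncomputable instance (R : Type u) [CommRing R] (m : ℕ) (b : Bool) :
    (poissonLang R b).Structure (SymplecticPoisson R m) where
  funMap f x := SymplecticPoisson.op (m := m) f x
  RelMap ρ := ρ.elim

/-- A commutative ring (with trivial derivations) is radically Noetherian if its radical ideals
satisfy the ascending chain condition. -/
def RadicallyNoetherian (R : Type u) [CommRing R] : Prop :=
  WellFoundedGT {I : Ideal R // I.IsRadical}

end UnivAlg

/-! The bracket of `Pₘ` is built from `2m` commuting derivations, so the problem moves to
differential algebra. A differential polynomial over `R` that vanishes at all tuples of ordinary
polynomials is zero, because over a domain containing `ℚ` the derivatives of a polynomial at the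
origin can be prescribed (`DiffPoly.eq_zero_of_forall_hom`). Hence the ring of differential
polynomials, with the bracket given by its derivations, satisfies the identities of `Pₘ`, and `F`
embeds into the ring `R{Y}` of differential polynomials in a copy `Y` of its free generators
(`IsFree.exists_injective_hom`).

An equation over `F` in `n` unknowns thus becomes a differential polynomial over `R{Y}` in `n`
further indeterminates. Evaluation at a point of `Fⁿ` is a differential homomorphism that fixes
`R{Y}`. Its kernel is a prime differential ideal that meets `R{Y}` in zero, hence is saturated with
respect to the nonzero elements of `R{Y}`.

For radical differential ideals with this saturation the Ritt–Raudenbush basis theorem holds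
(`isPerfectFG`), even for infinite `Y`: saturation plays the part of passing to the fraction field
of `R{Y}`. A maximal counterexample would be prime. For a prime ideal, Dickson's lemma selects
finitely many polynomials of least degree in their leading variables, and reduction by them and
their derivatives gives generators up to a multiplier outside the ideal
(`exists_finset_mul_mem_perfectClosure`). The resulting chain condition makes `Fⁿ` Noetherian
(`noetherianSpace_of_isPerfect`). -/

namespace DifferentialAlgebra

/-! ### Perfect ideals, and reduction of finite generation to primes -/

section Perfect

variable {R A κ : Type*} [CommRing R] [CommRing A] [Algebra R A]

/-- An ideal is perfect if it is radical, stable under the given derivations, and saturated with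
respect to the set `W`. -/
structure IsPerfect (δ : κ → Derivation R A A) (W : Set A) (I : Ideal A) : Prop where
  radical : I.IsRadical
  deriv : ∀ i, ∀ a ∈ I, δ i a ∈ I
  saturated : ∀ w ∈ W, ∀ a, w * a ∈ I → a ∈ I

/-- The smallest perfect ideal that contains `S`. -/
def perfectClosure (δ : κ → Derivation R A A) (W : Set A) (S : Set A) : Ideal A :=
  sInf {I | IsPerfect δ W I ∧ S ⊆ I}

variable {δ : κ → Derivation R A A} {W : Set A}

theorem mem_perfectClosure {S : Set A} {a : A} :
    a ∈ perfectClosure δ W S ↔ ∀ I, IsPerfect δ W I → S ⊆ I → a ∈ I := by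
  simp [perfectClosure, Submodule.mem_sInf]

theorem subset_perfectClosure (S : Set A) : S ⊆ perfectClosure δ W S :=
  fun _ ha => mem_perfectClosure.2 fun _ _ h => h ha

theorem perfectClosure_le {S : Set A} {I : Ideal A} (hI : IsPerfect δ W I) (h : S ⊆ I) :
    perfectClosure δ W S ≤ I :=
  fun _ ha => mem_perfectClosure.1 ha I hI h

theorem isPerfect_perfectClosure (S : Set A) : IsPerfect δ W (perfectClosure δ W S) where
  radical a := by
    rintro ⟨n, hn⟩
    exact mem_perfectClosure.2 fun I hI h => hI.radical ⟨n, mem_perfectClosure.1 hn I hI h⟩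
  deriv i a ha := mem_perfectClosure.2 fun I hI h =>
    hI.deriv i a (mem_perfectClosure.1 ha I hI h)
  saturated w hw a ha := mem_perfectClosure.2 fun I hI h =>
    hI.saturated w hw a (mem_perfectClosure.1 ha I hI h)

theorem perfectClosure_mono {S T : Set A} (h : S ⊆ T) :
    perfectClosure δ W S ≤ perfectClosure δ W T :=
  perfectClosure_le (isPerfect_perfectClosure T) (h.trans (subset_perfectClosure T))

theorem IsPerfect.mem_of_pow_mem {I : Ideal A} (hI : IsPerfect δ W I) {a : A} {n : ℕ}
    (h : a ^ n ∈ I) : a ∈ I :=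
  hI.radical ⟨n, h⟩

/-- The ideal of multipliers of a set into a perfect ideal is perfect. -/
theorem IsPerfect.exists_colon {I : Ideal A} (hI : IsPerfect δ W I) (S : Set A) :
    ∃ J : Ideal A, IsPerfect δ W J ∧ ∀ a, a ∈ J ↔ ∀ s ∈ S, a * s ∈ I := by
  refine ⟨⟨⟨⟨{a | ∀ s ∈ S, a * s ∈ I}, ?_⟩, ?_⟩, ?_⟩, ⟨?_, ?_, ?_⟩, fun a => Iff.rfl⟩
  · intro a b ha hb s hs
    rw [add_mul]
    exact I.add_mem (ha s hs) (hb s hs)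
  · intro s _
    simp
  · intro c a ha s hs
    rw [smul_eq_mul, mul_assoc]
    exact I.mul_mem_left c (ha s hs)
  · rintro a ⟨n, hn⟩ s hs
    refine hI.mem_of_pow_mem (n := n + 1) ?_
    have := I.mul_mem_left (a * s ^ n) (hn s hs)
    convert this using 1
    ring
  · intro i a ha s hs
    -- Multiplying `δ(as) = a δs + s δa` by `s δa` gives `(s δa)²` up to a multiple of `as`.
    refine hI.mem_of_pow_mem (n := 2) ?_
    have h := hI.deriv i _ (ha s hs)
    rw [Derivation.leibniz, smul_eq_mul, smul_eq_mul] at h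
    have h₁ := I.mul_mem_left (δ i a * s) h
    have h₂ := I.mul_mem_left (δ i s * δ i a) (ha s hs)
    convert I.sub_mem h₁ h₂ using 1
    ring
  · intro w hw a ha s hs
    refine hI.saturated w hw _ ?_
    rw [← mul_assoc]
    exact ha s hs

/-- Two passages to an ideal of multipliers, each perfect, extend the inclusion from the generators
first to one closure and then to the other. -/
theorem IsPerfect.mul_mem_of_mem_perfectClosure {I : Ideal A} (hI : IsPerfect δ W I) {S T : Set A}
    (h : ∀ s ∈ S, ∀ t ∈ T, s * t ∈ I) {a b : A} (ha : a ∈ perfectClosure δ W S)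
    (hb : b ∈ perfectClosure δ W T) : a * b ∈ I := by
  obtain ⟨J, hJ, hJm⟩ := hI.exists_colon T
  obtain ⟨K, hK, hKm⟩ := hI.exists_colon J
  have h₁ : a ∈ J := perfectClosure_le hJ (fun s hs => (hJm s).2 (h s hs)) ha
  have h₂ : b ∈ K := perfectClosure_le hK (fun t ht => (hKm t).2 fun c hc => by
    rw [mul_comm]; exact (hJm c).1 hc t ht) hb
  rw [mul_comm]
  exact (hKm b).1 h₂ a h₁

theorem isPerfect_of_directed {ι : Type*} [Nonempty ι] {J : ι → Ideal A}
    (hd : Directed (· ≤ ·) J) (hJ : ∀ i, IsPerfect δ W (J i)) : IsPerfect δ W (⨆ i, J i) where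
  radical := by
    rintro a ⟨n, hn⟩
    obtain ⟨i, hi⟩ := (Submodule.mem_iSup_of_directed J hd).1 hn
    exact (Submodule.mem_iSup_of_directed J hd).2 ⟨i, (hJ i).mem_of_pow_mem hi⟩
  deriv j a ha := by
    obtain ⟨i, hi⟩ := (Submodule.mem_iSup_of_directed J hd).1 ha
    exact (Submodule.mem_iSup_of_directed J hd).2 ⟨i, (hJ i).deriv j a hi⟩
  saturated w hw a ha := by
    obtain ⟨i, hi⟩ := (Submodule.mem_iSup_of_directed J hd).1 ha
    exact (Submodule.mem_iSup_of_directed J hd).2 ⟨i, (hJ i).saturated w hw a hi⟩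

-- The closures of the finite subsets of `S` form a directed family, so their union is already
-- perfect.
open Classical in
theorem exists_finset_of_mem_perfectClosure {S : Set A} {a : A} (ha : a ∈ perfectClosure δ W S) :
    ∃ T : Finset A, (T : Set A) ⊆ S ∧ a ∈ perfectClosure δ W (T : Set A) := by
  let J : {T : Finset A // (T : Set A) ⊆ S} → Ideal A := fun T => perfectClosure δ W (T.1 : Set A)
  have : Nonempty {T : Finset A // (T : Set A) ⊆ S} := ⟨⟨∅, by simp⟩⟩
  have hd : Directed (· ≤ ·) J := fun T T' =>
    ⟨⟨T.1 ∪ T'.1, by simp [T.2, T'.2]⟩, perfectClosure_mono (by simp),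
      perfectClosure_mono (by simp)⟩
  have hP : IsPerfect δ W (⨆ T, J T) :=
    isPerfect_of_directed hd fun T => isPerfect_perfectClosure _
  have h := perfectClosure_le hP (S := S) (fun s hs =>
    (Submodule.mem_iSup_of_directed J hd).2
      ⟨⟨{s}, by simpa using hs⟩, subset_perfectClosure _ (by simp)⟩) ha
  obtain ⟨T, hT⟩ := (Submodule.mem_iSup_of_directed J hd).1 h
  exact ⟨T.1, T.2, hT⟩

/-- A perfect ideal is finitely generated as such. -/
def IsPerfectFG (δ : κ → Derivation R A A) (W : Set A) (I : Ideal A) : Prop :=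
  ∃ T : Finset A, perfectClosure δ W (T : Set A) = I

-- The given finite generators need not lie in `I ∪ {a}`, but each of them lies in the closure of
-- finitely many elements of that set.
open Classical in
theorem exists_finset_perfectClosure_insert {I : Ideal A} {a : A}
    (h : IsPerfectFG δ W (perfectClosure δ W (insert a (I : Set A)))) :
    ∃ T : Finset A, (T : Set A) ⊆ I ∧
      (I : Set A) ⊆ perfectClosure δ W (insert a (T : Set A)) := by
  obtain ⟨U, hU⟩ := h
  have key : ∀ V : Finset A, V ⊆ U → ∃ T : Finset A, (T : Set A) ⊆ I ∧
      (V : Set A) ⊆ perfectClosure δ W (insert a (T : Set A)) := by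
    intro V
    induction V using Finset.induction_on with
    | empty => exact fun _ => ⟨∅, by simp, by simp⟩
    | insert x V _ ih =>
      intro hV
      obtain ⟨T, hT, hVT⟩ := ih ((Finset.subset_insert x V).trans hV)
      have hx : x ∈ perfectClosure δ W (insert a (I : Set A)) := by
        rw [← hU]
        exact subset_perfectClosure _ (hV (Finset.mem_insert_self x V))
      obtain ⟨T', hT', hxT⟩ := exists_finset_of_mem_perfectClosure hx
      refine ⟨T ∪ T'.erase a, ?_, ?_⟩
      · intro y hy
        simp only [Finset.coe_union, Finset.coe_erase, Set.mem_union, Set.mem_sdiff] at hy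
        rcases hy with hy | hy
        · exact hT hy
        · exact (hT' hy.1).resolve_left hy.2
      · rw [Finset.coe_insert]
        rintro y (rfl | hy)
        · refine perfectClosure_mono ?_ hxT
          intro z hz
          by_cases hza : z = a
          · exact Or.inl hza
          · right
            simp [hza, Finset.mem_coe.1 hz]
        · refine perfectClosure_mono ?_ (hVT hy)
          exact Set.insert_subset_insert (by simp)
  obtain ⟨T, hT, hUT⟩ := key U subset_rfl
  refine ⟨T, hT, fun x hx => ?_⟩
  have : x ∈ perfectClosure δ W (U : Set A) := by
    rw [hU]
    exact subset_perfectClosure _ (Or.inr hx)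
  exact perfectClosure_le (isPerfect_perfectClosure _) hUT this

open Classical in
/-- If modulo a multiplier every prime perfect ideal is finitely generated, then all perfect ideals
are finitely generated. -/
theorem isPerfectFG_of_prime
    (H : ∀ I : Ideal A, I.IsPrime → IsPerfect δ W I → ∃ T : Finset A, (T : Set A) ⊆ I ∧
      ∃ h ∉ I, ∀ g ∈ I, h * g ∈ perfectClosure δ W (T : Set A))
    {I : Ideal A} (hI : IsPerfect δ W I) : IsPerfectFG δ W I := by
  by_contra hfg
  obtain ⟨M, -, hM⟩ := zorn_le_nonempty₀ {J : Ideal A | IsPerfect δ W J ∧ ¬ IsPerfectFG δ W J}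
    (fun c hc hchain y hy => by
      have : Nonempty c := ⟨⟨y, hy⟩⟩
      have hd : Directed (· ≤ ·) (fun J : c => (J : Ideal A)) :=
        hchain.directedOn.directed_val
      have hP : IsPerfect δ W (⨆ J : c, (J : Ideal A)) :=
        isPerfect_of_directed hd fun J => (hc J.2).1
      refine ⟨⨆ J : c, (J : Ideal A), ⟨hP, ?_⟩, fun J hJ => le_iSup (fun J : c => (J : Ideal A)) ⟨J, hJ⟩⟩
      rintro ⟨T, hT⟩
      have key : ∃ J : c, (T : Set A) ⊆ (J : Ideal A) := by
        have hTs : ∀ t ∈ T, ∃ J : c, t ∈ (J : Ideal A) := fun t ht =>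
          (Submodule.mem_iSup_of_directed _ hd).1 (hT ▸ subset_perfectClosure _ ht)
        choose! f hf using hTs
        obtain ⟨J, hJ⟩ := hd.finset_le (T.image f)
        exact ⟨J, fun t ht => hJ (f t) (Finset.mem_image_of_mem f ht) (hf t ht)⟩
      obtain ⟨J, hJ⟩ := key
      refine (hc J.2).2 ⟨T, le_antisymm (perfectClosure_le (hc J.2).1 hJ) ?_⟩
      rw [hT]
      exact le_iSup (fun J : c => (J : Ideal A)) J) I ⟨hI, hfg⟩
  have hMP := hM.prop.1
  have hMN := hM.prop.2
  have step : ∀ a ∉ M, ∃ T : Finset A, (T : Set A) ⊆ M ∧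
      (M : Set A) ⊆ perfectClosure δ W (insert a (T : Set A)) := by
    intro a ha
    refine exists_finset_perfectClosure_insert ?_
    by_contra hN
    have hle : M ≤ perfectClosure δ W (insert a (M : Set A)) :=
      fun x hx => subset_perfectClosure _ (Or.inr hx)
    exact ha (hM.le_of_ge ⟨isPerfect_perfectClosure _, hN⟩ hle
      (subset_perfectClosure _ (Or.inl rfl)))
  -- For `x ∈ M` the square `x * x` then lies in the closure of `T`, so `T` would generate `M`.
  have conclude : ∀ {S S' : Set A} (T : Finset A), (T : Set A) ⊆ M →
      (M : Set A) ⊆ perfectClosure δ W S → (M : Set A) ⊆ perfectClosure δ W S' →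
      (∀ s ∈ S, ∀ t ∈ S', s * t ∈ perfectClosure δ W (T : Set A)) → False := by
    intro S S' T hT hS hS' h
    refine hMN ⟨T, le_antisymm (perfectClosure_le hMP hT) fun x hx => ?_⟩
    refine (isPerfect_perfectClosure _).mem_of_pow_mem (n := 2) ?_
    rw [pow_two]
    exact (isPerfect_perfectClosure _).mul_mem_of_mem_perfectClosure h (hS hx) (hS' hx)
  -- If `ab ∈ M` with `a, b ∉ M`, then `M` lies in the closures of `{a} ∪ T` and `{b} ∪ U`, and
  -- products of their generators lie in the closure of `{ab} ∪ T ∪ U`.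
  have hprime : M.IsPrime := by
    refine ⟨?_, ?_⟩
    · rintro rfl
      refine hMN ⟨{1}, (Ideal.eq_top_iff_one _).2 (subset_perfectClosure _ (by simp))⟩
    · intro a b hab
      by_contra! hn
      obtain ⟨T, hT, hMT⟩ := step a hn.1
      obtain ⟨U, hU, hMU⟩ := step b hn.2
      refine conclude (insert (a * b) (T ∪ U)) ?_ hMT hMU ?_
      · simp only [Finset.coe_insert, Finset.coe_union]
        exact Set.insert_subset hab (Set.union_subset hT hU)
      · rintro s hs t ht
        have sub : ∀ x, x = a * b ∨ x ∈ T ∨ x ∈ U →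
            x ∈ perfectClosure δ W ((insert (a * b) (T ∪ U) : Finset A) : Set A) := fun x hx =>
          subset_perfectClosure _ (by simpa using hx)
        rcases hs with rfl | hs
        · rcases ht with rfl | ht
          · exact sub _ (Or.inl rfl)
          · exact Ideal.mul_mem_left _ _ (sub t (Or.inr (Or.inr ht)))
        · exact Ideal.mul_mem_right _ _ (sub s (Or.inr (Or.inl hs)))
  obtain ⟨T, hT, h, hh, hg⟩ := H M hprime hMP
  obtain ⟨U, hU, hMU⟩ := step h hh
  refine conclude (T ∪ U) (by simp [hT, hU]) (S := M) (subset_perfectClosure _) hMU ?_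
  rintro s hs t (rfl | ht)
  · rw [mul_comm]
    exact perfectClosure_mono (by simp) (hg s hs)
  · exact Ideal.mul_mem_left _ _ (subset_perfectClosure _ (by simp [Finset.mem_coe.1 ht]))

end Perfect

end DifferentialAlgebra

namespace DifferentialAlgebra

/-! ### Pseudo-division and polynomials of minimal degree -/

section PseudoDivision

open Polynomial

theorem exists_pseudo_division {S : Type*} [CommRing S] (p q : S[X]) (hp : 0 < p.natDegree) :
    ∃ (e : ℕ) (a r : S[X]), C p.leadingCoeff ^ e * q = a * p + r ∧ r.natDegree < p.natDegree := by
  induction hd : q.natDegree using Nat.strong_induction_on generalizing q with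
  | _ d ih =>
    by_cases hlt : q.natDegree < p.natDegree
    · exact ⟨0, 0, q, by simp, hlt⟩
    · have hle : p.natDegree ≤ d := by omega
      set q' := C p.leadingCoeff * q - C q.leadingCoeff * X ^ (d - p.natDegree) * p with hq'
      have hdeg : q'.natDegree ≤ d - 1 := by
        apply natDegree_le_pred
        · refine (natDegree_sub_le _ _).trans (max_le ?_ ?_)
          · exact (natDegree_C_mul_le _ _).trans hd.le
          · refine natDegree_mul_le.trans ?_
            have := natDegree_C_mul_X_pow_le q.leadingCoeff (d - p.natDegree)
            omega
        · rw [hq', coeff_sub, coeff_C_mul, mul_assoc, coeff_C_mul, coeff_X_pow_mul',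
            if_pos (by omega), Nat.sub_sub_self hle]
          simp only [leadingCoeff, hd]
          ring
      obtain ⟨e, a, r, h, hr⟩ := ih q'.natDegree (by omega) q' rfl
      refine ⟨e + 1, a + C p.leadingCoeff ^ e * (C q.leadingCoeff * X ^ (d - p.natDegree)), r, ?_, hr⟩
      have : C p.leadingCoeff * q = q' + C q.leadingCoeff * X ^ (d - p.natDegree) * p := by
        rw [hq']; ring
      rw [pow_succ, mul_assoc, this, mul_add, h]
      ring

variable {R A : Type*} [CommRing R] [CommRing A] [Algebra R A]

/-- The leading term can be subtracted as soon as its coefficient lies in `I`; the degree stays at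
most `d`, so the hypothesis applies again. -/
theorem coeff_mem_of_forall_leadingCoeff_mem {S : Subalgebra R A} {I : Ideal A} {x : A} (d : ℕ)
    (H : ∀ q : S[X], aeval x q ∈ I → q.natDegree ≤ d → (q.leadingCoeff : A) ∈ I) (q : S[X])
    (hq : aeval x q ∈ I) (hd : q.natDegree ≤ d) (k : ℕ) : (q.coeff k : A) ∈ I := by
  induction hn : q.support.card using Nat.strong_induction_on generalizing q with
  | _ n ih =>
    by_cases h0 : q = 0
    · simp [h0]
    · have hl := H q hq hd
      have hsum := q.eraseLead_add_C_mul_X_pow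
      have hmem : aeval x q.eraseLead ∈ I := by
        have : aeval x q.eraseLead = aeval x q - q.leadingCoeff * x ^ q.natDegree := by
          refine eq_sub_of_add_eq ?_
          have h := congrArg (aeval x) hsum
          rwa [map_add, map_mul, map_pow, aeval_C, aeval_X] at h
        rw [this]
        exact I.sub_mem hq (I.mul_mem_right _ hl)
      have := ih _ (by have := eraseLead_support_card_lt h0; omega) q.eraseLead hmem
        (eraseLead_natDegree_le_aux.trans hd) rfl
      rw [eraseLead_coeff] at this
      split_ifs at this with hk
      · rwa [hk]
      · exact this

theorem aeval_eq_sum_coeff {S : Subalgebra R A} (x : A) (q : S[X]) :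
    aeval x q = ∑ k ∈ q.support, (q.coeff k : A) * x ^ k := by
  rw [aeval_def, eval₂_eq_sum, Polynomial.sum_def]
  rfl

/-- A polynomial of minimal degree among those that vanish modulo a prime ideal and whose leading
coefficients do not. -/
theorem exists_minimal_polynomial [Algebra ℚ A] {S : Subalgebra R A} {I : Ideal A} {x : A}
    (h : ∃ p : S[X], aeval x p ∈ I ∧ (p.leadingCoeff : A) ∉ I) :
    ∃ p : S[X], aeval x p ∈ I ∧ (p.leadingCoeff : A) ∉ I ∧ 0 < p.natDegree ∧
      aeval x (derivative p) ∉ I ∧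
      ∀ q : S[X], aeval x q ∈ I → q.natDegree < p.natDegree → ∀ k, (q.coeff k : A) ∈ I := by
  classical
  have h' : ∃ d, ∃ p : S[X], p.natDegree = d ∧ aeval x p ∈ I ∧ (p.leadingCoeff : A) ∉ I :=
    let ⟨p, hp⟩ := h; ⟨_, p, rfl, hp⟩
  obtain ⟨p, hpd, hpI, hpl⟩ := Nat.find_spec h'
  have hmin : ∀ q : S[X], aeval x q ∈ I → q.natDegree < p.natDegree → ∀ k, (q.coeff k : A) ∈ I := by
    intro q hq hlt
    refine coeff_mem_of_forall_leadingCoeff_mem q.natDegree (fun q' hq' hd' => ?_) q hq le_rfl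
    by_contra hN
    exact Nat.find_min h' (m := q'.natDegree) (by omega) ⟨q', rfl, hq', hN⟩
  have hpos : 0 < p.natDegree := by
    rw [Nat.pos_iff_ne_zero]
    intro h0
    have := eq_C_of_natDegree_eq_zero h0
    rw [leadingCoeff, h0] at hpl
    rw [this, aeval_C] at hpI
    exact hpl hpI
  refine ⟨p, hpI, hpl, hpos, fun hder => ?_, hmin⟩
  -- The derivative has smaller degree, so its coefficients would lie in `I`; the top one is the
  -- degree times the initial, and the degree is invertible.
  have hc := hmin _ hder (natDegree_derivative_lt hpos.ne') (p.natDegree - 1)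
  rw [coeff_derivative, Nat.sub_add_cancel hpos] at hc
  apply hpl
  have h1 : ((p.coeff p.natDegree * (((p.natDegree - 1 : ℕ) : S) + 1) : S) : A) =
      (p.natDegree : ℚ) • (p.leadingCoeff : A) := by
    rw [Nat.cast_smul_eq_nsmul, nsmul_eq_mul, ← Nat.cast_succ, Nat.succ_eq_add_one,
      Nat.sub_add_cancel hpos]
    push_cast
    rw [mul_comm, leadingCoeff]
  rw [h1] at hc
  have h2 := I.mul_mem_left (algebraMap ℚ A (p.natDegree : ℚ)⁻¹) hc
  rwa [← Algebra.smul_def, smul_smul, inv_mul_cancel₀ (by exact_mod_cast hpos.ne'), one_smul] at h2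

/-- Since the initial of `r` divides `h`, a power of `h` suffices to pseudo-divide `q` by `r`.
Radicality of `J` removes the exponent, and the remainder is handled by `H`. -/
theorem mul_aeval_mem_of_pseudo_division {S : Subalgebra R A} {I J : Ideal A} (hJI : J ≤ I)
    (hJ : J.IsRadical) {x h : A} {r : S[X]} (hrJ : aeval x r ∈ J)
    (hrh : (r.leadingCoeff : A) ∣ h) (hr : 0 < r.natDegree)
    (H : ∀ b : S[X], aeval x b ∈ I → b.natDegree < r.natDegree → h * aeval x b ∈ J)
    {q : S[X]} (hq : aeval x q ∈ I) : h * aeval x q ∈ J := by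
  obtain ⟨e, a, b, hab, hb⟩ := exists_pseudo_division r q hr
  have hab' : (r.leadingCoeff : A) ^ e * aeval x q = aeval x a * aeval x r + aeval x b := by
    have := congrArg (aeval x) hab
    rwa [map_mul, map_pow, aeval_C, map_add, map_mul] at this
  have hbI : aeval x b ∈ I := by
    have := I.sub_mem (I.mul_mem_left ((r.leadingCoeff : A) ^ e) hq)
      (I.mul_mem_left (aeval x a) (hJI hrJ))
    rwa [hab', add_sub_cancel_left] at this
  have hbJ := H b hbI hb
  obtain ⟨c, hc⟩ := hrh
  refine hJ ⟨e + 1, ?_⟩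
  have key : (h * aeval x q) ^ (e + 1) = (c ^ e * aeval x q ^ e * h * aeval x a) * aeval x r +
      (c ^ e * aeval x q ^ e) * (h * aeval x b) := by
    calc (h * aeval x q) ^ (e + 1) = h ^ e * aeval x q ^ e * h * aeval x q := by ring
      _ = c ^ e * aeval x q ^ e * h * ((r.leadingCoeff : A) ^ e * aeval x q) := by
        nth_rewrite 1 [hc]; ring
      _ = _ := by rw [hab']; ring
  rw [key]
  exact J.add_mem (J.mul_mem_left _ hrJ) (J.mul_mem_left _ hbJ)

/-- The chain rule: `t` is obtained by applying `D` to the coefficients of `q` only. -/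
theorem Derivation.exists_aeval_eq (D : Derivation R A A) {S S' : Subalgebra R A} (x : A)
    (hx : x ∈ S') (hS : ∀ s ∈ S, D s ∈ S') (q : S[X]) :
    ∃ t ∈ S', D (aeval x q) = aeval x (derivative q) * D x + t := by
  induction q using Polynomial.induction_on' with
  | add p q hp hq =>
    obtain ⟨t, ht, h⟩ := hp
    obtain ⟨t', ht', h'⟩ := hq
    refine ⟨t + t', S'.add_mem ht ht', ?_⟩
    rw [map_add, map_add, h, h', derivative_add, map_add]
    ring
  | monomial n a =>
    refine ⟨D a * x ^ n, S'.mul_mem (hS _ a.2) (S'.pow_mem hx n), ?_⟩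
    have hval : ∀ b : S, algebraMap S A b = b := fun _ => rfl
    rw [derivative_monomial, aeval_monomial, aeval_monomial, hval, hval, Derivation.leibniz, Derivation.leibniz_pow]
    simp only [smul_eq_mul, nsmul_eq_mul]
    push_cast
    ring

end PseudoDivision

/-! ### Differential polynomials and the Ritt–Raudenbush theorem -/

section DiffPoly

open MvPolynomial

/-- The ring of differential polynomials in the indeterminates `Y` over the ring of constants `R`,
with `k` commuting derivations: the variable `(y, α)` is the derivative of `y` of multi-order `α`. -/
abbrev DiffPoly (R : Type u) [CommRing R] (k : ℕ) (Y : Type v) : Type (max u v) :=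
  MvPolynomial (Y × (Fin k →₀ ℕ)) R

/-- The `i`-th derivative of a variable. -/
noncomputable def shift {k : ℕ} {Y : Type v} (i : Fin k) (v : Y × (Fin k →₀ ℕ)) :
    Y × (Fin k →₀ ℕ) :=
  (v.1, v.2 + Finsupp.single i 1)

/-- The `i`-th derivation of the ring of differential polynomials. -/
noncomputable def DiffPoly.deriv (R : Type u) [CommRing R] {k : ℕ} (Y : Type v) (i : Fin k) :
    Derivation R (DiffPoly R k Y) (DiffPoly R k Y) :=
  mkDerivation R fun v => X (shift i v)

variable {R : Type u} [CommRing R] {k : ℕ}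

@[simp]
theorem DiffPoly.deriv_X {Y : Type v} (i : Fin k) (v : Y × (Fin k →₀ ℕ)) :
    DiffPoly.deriv R Y i (X v) = X (shift i v) :=
  mkDerivation_X _ _ _

theorem DiffPoly.deriv_mem_supported {Y : Type v} {s t : Set (Y × (Fin k →₀ ℕ))} (hst : s ⊆ t)
    {i : Fin k} (h : ∀ u ∈ s, shift i u ∈ t) {p : DiffPoly R k Y} (hp : p ∈ supported R s) :
    DiffPoly.deriv R Y i p ∈ supported R t := by
  rw [supported_eq_adjoin_X] at hp
  have hle : Algebra.adjoin R (X '' s) ≤ supported R t := supported_mono hst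
  induction hp using Algebra.adjoin_induction with
  | mem x hx =>
    obtain ⟨u, hu, rfl⟩ := hx
    rw [deriv_X]
    exact Algebra.subset_adjoin ⟨_, h u hu, rfl⟩
  | algebraMap r => rw [Derivation.map_algebraMap]; exact Subalgebra.zero_mem _
  | add x y _ _ hx hy => rw [map_add]; exact Subalgebra.add_mem _ hx hy
  | mul x y hxs hys hx hy =>
    rw [Derivation.leibniz]
    exact Subalgebra.add_mem _ (Subalgebra.mul_mem _ (hle hxs) hy)
      (Subalgebra.mul_mem _ (hle hys) hx)

variable {X' : Type v} {n : ℕ}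

/-- The position of a variable in a well-order: the variables of the coefficients come first, the
other ones are ordered by indeterminate and then lexicographically by multi-order. -/
noncomputable def rank : (X' ⊕ Fin n) × (Fin k →₀ ℕ) →
    WithBot (Fin n ×ₗ (MonomialOrder.lex (σ := Fin k)).syn)
  | (Sum.inl _, _) => ⊥
  | (Sum.inr j, α) => ((toLex (j, MonomialOrder.lex.toSyn α) :
      Fin n ×ₗ (MonomialOrder.lex (σ := Fin k)).syn) : WithBot _)

theorem rank_shift_lt {i : Fin k} {u : (X' ⊕ Fin n) × (Fin k →₀ ℕ)} {j : Fin n} {α : Fin k →₀ ℕ}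
    (h : rank u < rank (X' := X') (Sum.inr j, α)) :
    rank (shift i u) < rank (X' := X') (shift i (Sum.inr j, α)) := by
  obtain ⟨_ | j', β⟩ := u
  · exact WithBot.bot_lt_coe _
  · simp only [rank, shift, WithBot.coe_lt_coe, Prod.Lex.toLex_lt_toLex, map_add] at h ⊢
    rcases h with h | ⟨h, h'⟩
    · exact Or.inl h
    · exact Or.inr ⟨h, by simpa using h'⟩

theorem rank_lt_rank_shift {i : Fin k} {j : Fin n} {α : Fin k →₀ ℕ} :
    rank (X' := X') (Sum.inr j, α) < rank (X' := X') (shift i (Sum.inr j, α)) := by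
  simp only [rank, shift, WithBot.coe_lt_coe, Prod.Lex.toLex_lt_toLex, map_add]
  refine Or.inr ⟨trivial, lt_add_of_pos_right _ ?_⟩
  rw [MonomialOrder.toSyn_lt_iff_ne_zero]
  simp

theorem eq_of_rank_eq {u : (X' ⊕ Fin n) × (Fin k →₀ ℕ)} {j : Fin n} {α : Fin k →₀ ℕ}
    (h : rank u = rank (X' := X') (Sum.inr j, α)) : u = (Sum.inr j, α) := by
  obtain ⟨_ | j', β⟩ := u
  · simp [rank] at h
  · simpa [rank] using h

variable (R) in
/-- The differential polynomials in the variables that precede `v`. -/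
noncomputable def below (v : (X' ⊕ Fin n) × (Fin k →₀ ℕ)) :
    Subalgebra R (DiffPoly R k (X' ⊕ Fin n)) :=
  supported R {u | rank u < rank v}

theorem exists_aeval_eq_of_mem_supported {j : Fin n} {α : Fin k →₀ ℕ}
    {g : DiffPoly R k (X' ⊕ Fin n)}
    (hg : g ∈ supported R {u | rank u ≤ rank (X' := X') (Sum.inr j, α)}) :
    ∃ q : Polynomial (below R (X' := X') (Sum.inr j, α)),
      Polynomial.aeval (X (Sum.inr j, α)) q = g := by
  have : supported R {u | rank u ≤ rank (X' := X') (Sum.inr j, α)} ≤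
      ((Polynomial.aeval (R := below R (X' := X') (Sum.inr j, α))
        (X (Sum.inr j, α) : DiffPoly R k (X' ⊕ Fin n))).restrictScalars R).range := by
    refine Algebra.adjoin_le ?_
    rintro _ ⟨u, hu, rfl⟩
    rcases (show rank u ≤ _ from hu).lt_or_eq with h | h
    · exact ⟨Polynomial.C ⟨X u, Algebra.subset_adjoin ⟨u, h, rfl⟩⟩,
        by simp⟩
    · exact ⟨Polynomial.X, by simp [eq_of_rank_eq h]⟩
  exact this hg

theorem below_mono_shift {i : Fin k} {j : Fin n} {α : Fin k →₀ ℕ}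
    {p : DiffPoly R k (X' ⊕ Fin n)} (hp : p ∈ below R (X' := X') (Sum.inr j, α)) :
    p ∈ below R (X' := X') (shift i (Sum.inr j, α)) :=
  supported_mono (fun _ hu => lt_trans hu rank_lt_rank_shift) hp

theorem deriv_mem_below_shift {i : Fin k} {j : Fin n} {α : Fin k →₀ ℕ}
    {p : DiffPoly R k (X' ⊕ Fin n)} (hp : p ∈ below R (X' := X') (Sum.inr j, α)) :
    DiffPoly.deriv R _ i p ∈ below R (X' := X') (shift i (Sum.inr j, α)) :=
  DiffPoly.deriv_mem_supported (fun _ hu => lt_trans hu rank_lt_rank_shift)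
    (fun _ hu => rank_shift_lt hu) hp

theorem X_mem_below_shift {i : Fin k} {j : Fin n} {α : Fin k →₀ ℕ} :
    (X (Sum.inr j, α) : DiffPoly R k (X' ⊕ Fin n)) ∈ below R (shift i (Sum.inr j, α)) :=
  Algebra.subset_adjoin ⟨_, rank_lt_rank_shift, rfl⟩

theorem aeval_mem_below_shift {i : Fin k} {j : Fin n} {α : Fin k →₀ ℕ}
    (p : Polynomial (below R (X' := X') (Sum.inr j, α))) :
    Polynomial.aeval (X (Sum.inr j, α)) p ∈ below R (X' := X') (shift i (Sum.inr j, α)) := by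
  rw [aeval_eq_sum_coeff]
  exact Subalgebra.sum_mem _ fun l _ => Subalgebra.mul_mem _ (below_mono_shift (p.coeff l).2)
    (Subalgebra.pow_mem _ X_mem_below_shift l)

theorem finsupp_shift_induction {P : (Fin k →₀ ℕ) → Prop} (h0 : P 0)
    (hs : ∀ i β, P β → P (β + Finsupp.single i 1)) (β : Fin k →₀ ℕ) : P β := by
  induction hd : β.degree using Nat.strong_induction_on generalizing β with
  | _ d ih =>
    by_cases hβ : β = 0
    · rwa [hβ]
    · obtain ⟨i, hi⟩ := Finsupp.ne_iff.1 hβ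
      have hle : Finsupp.single i 1 ≤ β := by
        rw [Finsupp.single_le_iff]
        exact Nat.one_le_iff_ne_zero.2 hi
      rw [← tsub_add_cancel_of_le hle]
      refine hs i _ (ih _ ?_ _ rfl)
      rw [← hd]
      conv_rhs => rw [← tsub_add_cancel_of_le hle]
      simp

/-- The proper derivatives of a polynomial are linear in their leading variables, with the
separant as coefficient. -/
theorem exists_separant_mul_X_add_mem {J : Ideal (DiffPoly R k (X' ⊕ Fin n))}
    (hJ : ∀ i, ∀ a ∈ J, DiffPoly.deriv R _ i a ∈ J) {j : Fin n} {α : Fin k →₀ ℕ}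
    (p : Polynomial (below R (X' := X') (Sum.inr j, α)))
    (hp : Polynomial.aeval (X (Sum.inr j, α)) p ∈ J) (β : Fin k →₀ ℕ) (hβ : β ≠ 0) :
    let s : DiffPoly R k (X' ⊕ Fin n) :=
      Polynomial.aeval (X (Sum.inr j, α)) (Polynomial.derivative p)
    s ∈ below R (X' := X') (Sum.inr j, α + β) ∧
      ∃ t ∈ below R (X' := X') (Sum.inr j, α + β), s * X (Sum.inr j, α + β) + t ∈ J := by
  intro s
  revert hβ
  induction β using finsupp_shift_induction with
  | h0 => exact fun h => absurd rfl h
  | hs i β ih =>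
    intro _
    have hsh : ((Sum.inr j, α + (β + Finsupp.single i 1)) : (X' ⊕ Fin n) × (Fin k →₀ ℕ)) =
      shift i (Sum.inr j, α + β) := by simp [shift, add_assoc]
    rw [hsh]
    -- The first derivative is linear in the new variable by the chain rule; each later one keeps
    -- the factor `s`, and the term with `δ s` involves lower variables only.
    by_cases hβ : β = 0
    · subst hβ
      rw [add_zero]
      obtain ⟨t, ht, h⟩ := Derivation.exists_aeval_eq (DiffPoly.deriv R (X' ⊕ Fin n) i)
        (S' := below R (X' := X') (shift i (Sum.inr j, α))) (X (Sum.inr j, α)) X_mem_below_shift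
        (fun _ => deriv_mem_below_shift) p
      refine ⟨aeval_mem_below_shift _, t, ht, ?_⟩
      have := hJ i _ hp
      rwa [h, DiffPoly.deriv_X] at this
    · obtain ⟨hs, t, ht, h⟩ := ih hβ
      refine ⟨below_mono_shift hs, DiffPoly.deriv R _ i s * X (Sum.inr j, α + β) +
        DiffPoly.deriv R _ i t, ?_, ?_⟩
      · exact Subalgebra.add_mem _ (Subalgebra.mul_mem _ (deriv_mem_below_shift hs)
          X_mem_below_shift) (deriv_mem_below_shift ht)
      · have := hJ i _ h
        rw [map_add, Derivation.leibniz, DiffPoly.deriv_X, smul_eq_mul, smul_eq_mul] at this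
        convert this using 1
        ring

/-- Differentiating `α - β` times makes the polynomial linear in the variable of order `α`. The
separant must be nonzero for the degree to be exactly one. -/
theorem exists_linear_polynomial {J : Ideal (DiffPoly R k (X' ⊕ Fin n))}
    (hJ : ∀ i, ∀ a ∈ J, DiffPoly.deriv R _ i a ∈ J) {j : Fin n} {α β : Fin k →₀ ℕ}
    (p : Polynomial (below R (X' := X') (Sum.inr j, β)))
    (hp : Polynomial.aeval (X (Sum.inr j, β)) p ∈ J)
    (hs0 : Polynomial.aeval (X (Sum.inr j, β) : DiffPoly R k (X' ⊕ Fin n))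
      (Polynomial.derivative p) ≠ 0) (hβ : β < α) :
    ∃ r : Polynomial (below R (X' := X') (Sum.inr j, α)),
      Polynomial.aeval (X (Sum.inr j, α)) r ∈ J ∧
      (r.leadingCoeff : DiffPoly R k (X' ⊕ Fin n)) =
        Polynomial.aeval (X (Sum.inr j, β)) (Polynomial.derivative p) ∧ r.natDegree = 1 := by
  obtain ⟨hs, t, ht, hmem⟩ := exists_separant_mul_X_add_mem hJ p hp (α - β)
    (fun h0 => hβ.not_ge (tsub_eq_zero_iff_le.1 h0))
  rw [add_tsub_cancel_of_le hβ.le] at hs ht hmem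
  have hs0' : (⟨_, hs⟩ : below R (X' := X') (Sum.inr j, α)) ≠ 0 :=
    fun h => hs0 (congrArg Subtype.val h)
  refine ⟨Polynomial.C ⟨_, hs⟩ * Polynomial.X + Polynomial.C ⟨t, ht⟩, ?_, ?_, ?_⟩
  · rwa [map_add, map_mul, Polynomial.aeval_C, Polynomial.aeval_C, Polynomial.aeval_X]
  · rw [Polynomial.leadingCoeff_linear hs0']
  · rw [Polynomial.natDegree_linear hs0']

variable (R k X' n) in
/-- The nonzero coefficients of differential polynomials in the second group of indeterminates. -/
def coefficients : Set (DiffPoly R k (X' ⊕ Fin n)) :=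
  {a | a ∈ supported R {v : (X' ⊕ Fin n) × (Fin k →₀ ℕ) | rank v = ⊥} ∧ a ≠ 0}

/-- `v` is the leading variable of a polynomial in `I` whose initial is not in `I`. -/
def IsLeader (I : Ideal (DiffPoly R k (X' ⊕ Fin n))) (v : (X' ⊕ Fin n) × (Fin k →₀ ℕ)) : Prop :=
  ∃ p : Polynomial (below R v), Polynomial.aeval (X v : DiffPoly R k (X' ⊕ Fin n)) p ∈ I ∧
    (p.leadingCoeff : DiffPoly R k (X' ⊕ Fin n)) ∉ I

/-- Dickson's lemma for each of the `n` indeterminates: the minimal multi-orders form an antichain,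
hence a finite set. -/
theorem exists_finset_le_of_forall_mem (L : Set (Fin n × (Fin k →₀ ℕ))) :
    ∃ T : Finset (Fin n × (Fin k →₀ ℕ)), (T : Set _) ⊆ L ∧
      ∀ v ∈ L, ∃ β, (v.1, β) ∈ T ∧ β ≤ v.2 := by
  classical
  have hfin : ∀ j, {α | Minimal (fun α => (j, α) ∈ L) α}.Finite := fun j =>
    WellQuasiOrderedLE.finite_of_isAntichain (setOfPred_minimal_antichain _)
  refine ⟨Finset.univ.biUnion fun j => (hfin j).toFinset.image fun α => (j, α), ?_, ?_⟩
  · intro v hv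
    simp only [Finset.coe_biUnion, Finset.coe_image, Set.mem_iUnion, Set.Finite.coe_toFinset] at hv
    obtain ⟨j, -, α, hα, rfl⟩ := hv
    exact hα.out.1
  · rintro ⟨j, α⟩ hv
    obtain ⟨β, hβ, hmin⟩ := exists_minimal_le_of_wellFoundedLT (fun α => (j, α) ∈ L) α hv
    refine ⟨β, ?_, hβ⟩
    simp only [Finset.mem_biUnion, Finset.mem_univ, Finset.mem_image, Set.Finite.mem_toFinset,
      true_and]
    exact ⟨j, β, hmin, rfl⟩

/-- Minimal polynomials at the finitely many minimal leaders play the part of a characteristic set,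
and `h` is the product of their initials and separants. Primality keeps `h` outside `I`. Every
element of `I` reduces by these polynomials and their derivatives to one whose coefficients in the
leading variable lie in `I` and have smaller rank. -/
theorem exists_finset_mul_mem_perfectClosure [Algebra ℚ R]
    (I : Ideal (DiffPoly R k (X' ⊕ Fin n))) (hprime : I.IsPrime)
    (hI : IsPerfect (DiffPoly.deriv R (X' ⊕ Fin n)) (coefficients R k X' n) I) :
    ∃ T : Finset (DiffPoly R k (X' ⊕ Fin n)), (T : Set (DiffPoly R k (X' ⊕ Fin n))) ⊆ I ∧
      ∃ h ∉ I, ∀ g ∈ I,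
      h * g ∈ perfectClosure (DiffPoly.deriv R (X' ⊕ Fin n)) (coefficients R k X' n)
        (T : Set (DiffPoly R k (X' ⊕ Fin n))) := by
  classical
  -- Minimal polynomials are chosen at all leaders: outside `Λ` their degrees are still needed to
  -- control remainders.
  have hmin := fun v (h : IsLeader I v) => exists_minimal_polynomial h
  choose p hpI hpl hppos hpd hpmin using hmin
  obtain ⟨Λ, hΛ, hΛle⟩ := exists_finset_le_of_forall_mem
    {v : Fin n × (Fin k →₀ ℕ) | IsLeader I (Sum.inr v.1, v.2)}
  have hΛ' : ∀ v ∈ Λ, IsLeader I ((Sum.inr v.1, v.2) : (X' ⊕ Fin n) × (Fin k →₀ ℕ)) :=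
    fun v hv => hΛ hv
  obtain ⟨f, hf⟩ : ∃ f : Λ → DiffPoly R k (X' ⊕ Fin n), ∀ j α (h : (j, α) ∈ Λ),
      f ⟨_, h⟩ = Polynomial.aeval (X (Sum.inr j, α)) (p _ (hΛ' _ h)) :=
    ⟨fun v => Polynomial.aeval (X (Sum.inr v.1.1, v.1.2)) (p _ (hΛ' v.1 v.2)), fun _ _ _ => rfl⟩
  obtain ⟨lc, hlc⟩ : ∃ lc : Λ → DiffPoly R k (X' ⊕ Fin n), ∀ j α (h : (j, α) ∈ Λ),
      lc ⟨_, h⟩ = (p _ (hΛ' _ h)).leadingCoeff :=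
    ⟨fun v => (p _ (hΛ' v.1 v.2)).leadingCoeff, fun _ _ _ => rfl⟩
  obtain ⟨sep, hsep⟩ : ∃ sep : Λ → DiffPoly R k (X' ⊕ Fin n), ∀ j α (h : (j, α) ∈ Λ),
      sep ⟨_, h⟩ = Polynomial.aeval (X (Sum.inr j, α)) (Polynomial.derivative (p _ (hΛ' _ h))) :=
    ⟨fun v => Polynomial.aeval (X (Sum.inr v.1.1, v.1.2))
      (Polynomial.derivative (p _ (hΛ' v.1 v.2))), fun _ _ _ => rfl⟩
  set T : Finset (DiffPoly R k (X' ⊕ Fin n)) := Finset.univ.image f with hT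
  set J := perfectClosure (DiffPoly.deriv R (X' ⊕ Fin n)) (coefficients R k X' n)
    (T : Set (DiffPoly R k (X' ⊕ Fin n))) with hJdef
  have hJ : IsPerfect (DiffPoly.deriv R (X' ⊕ Fin n)) (coefficients R k X' n) J :=
    isPerfect_perfectClosure _
  obtain ⟨h, hh⟩ : ∃ h, h = ∏ v : Λ, lc v * sep v := ⟨_, rfl⟩
  have hdvd : ∀ v : Λ, lc v * sep v ∣ h := fun v => by
    rw [hh]
    exact Finset.dvd_prod_of_mem (fun v => lc v * sep v) (Finset.mem_univ v)
  have hfJ : ∀ v, f v ∈ J := fun v =>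
    subset_perfectClosure _ (by simp [hT])
  have hTI : (T : Set (DiffPoly R k (X' ⊕ Fin n))) ⊆ I := by
    intro x hx
    rw [hT, Finset.coe_image] at hx
    obtain ⟨⟨⟨j, α⟩, hv⟩, -, rfl⟩ := hx
    rw [hf]
    exact hpI _ (hΛ' _ hv)
  have hJI : J ≤ I := perfectClosure_le hI hTI
  refine ⟨T, hTI, h, ?_, ?_⟩
  · rw [hh, Ideal.IsPrime.prod_mem_iff]
    rintro ⟨⟨⟨j, α⟩, hv⟩, -, h⟩
    rcases hprime.mem_or_mem h with h | h
    · exact hpl _ (hΛ' _ hv) (hlc j α hv ▸ h)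
    · exact hpd _ (hΛ' _ hv) (hsep j α hv ▸ h)
  -- Well-founded induction on a bound for the ranks of the variables of `g`.
  suffices H : ∀ κ, ∀ g ∈ I, (∀ u ∈ g.vars, rank u ≤ κ) → h * g ∈ J from fun g hg =>
    H (g.vars.sup rank) g hg fun u hu => Finset.le_sup hu
  intro κ
  induction κ using WellFoundedLT.induction with
  | ind κ ih =>
  intro g hg hgκ
  cases κ with
  | bot =>
    -- A nonzero `g ∈ I` without proper variables is a coefficient, and saturation would put `1`
    -- into `I`.
    suffices g = 0 by simp [this]
    by_contra hg0
    refine hprime.ne_top ((Ideal.eq_top_iff_one _).2 (hI.saturated g ⟨?_, hg0⟩ 1 (by simpa)))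
    rw [mem_supported]
    exact fun u hu => le_bot_iff.1 (hgκ u hu)
  | coe κ =>
  obtain ⟨j, a⟩ := κ
  obtain ⟨α, rfl⟩ := (MonomialOrder.lex (σ := Fin k)).toSyn.surjective a
  set v : (X' ⊕ Fin n) × (Fin k →₀ ℕ) := (Sum.inr j, α) with hv
  have hκ : ((toLex (j, MonomialOrder.lex.toSyn α) :
      Fin n ×ₗ (MonomialOrder.lex (σ := Fin k)).syn) : WithBot _) = rank v := rfl
  change ∀ u ∈ g.vars, rank u ≤ rank v at hgκ
  have ih' : ∀ c ∈ I, c ∈ below R v → h * c ∈ J := by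
    intro c hc hcv
    refine ih (c.vars.sup rank) ?_ c hc fun u hu => Finset.le_sup hu
    change _ < rank v
    rw [Finset.sup_lt_iff (by rw [← hκ]; exact WithBot.bot_lt_coe _)]
    exact fun u hu => mem_supported.1 hcv hu
  have ihp : ∀ q : Polynomial (below R v),
      (∀ l, (q.coeff l : DiffPoly R k (X' ⊕ Fin n)) ∈ I) →
      h * Polynomial.aeval (X v : DiffPoly R k (X' ⊕ Fin n)) q ∈ J := by
    intro q hq
    rw [aeval_eq_sum_coeff, Finset.mul_sum]
    refine J.sum_mem fun l _ => ?_
    rw [← mul_assoc]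
    exact J.mul_mem_right _ (ih' _ (hq l) (q.coeff l).2)
  obtain ⟨q, hq⟩ := exists_aeval_eq_of_mem_supported (R := R) (mem_supported.2 hgκ)
  by_cases hlead : IsLeader I v
  -- The reducer is the chosen polynomial if `(j, α) ∈ Λ`, and otherwise a derivative, linear in
  -- `v`, of one at a smaller leader. Its degree is at most the minimal one, so a remainder lying in
  -- `I` has all its coefficients in `I`.
  · obtain ⟨r, hrJ, hrh, hrpos, hrmin⟩ : ∃ r : Polynomial (below R v),
        Polynomial.aeval (X v : DiffPoly R k (X' ⊕ Fin n)) r ∈ J ∧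
        (r.leadingCoeff : DiffPoly R k (X' ⊕ Fin n)) ∣ h ∧ 0 < r.natDegree ∧
        r.natDegree ≤ (p v hlead).natDegree := by
      obtain ⟨β, hβΛ, hβ⟩ := hΛle (j, α) hlead
      by_cases hβα : β = α
      · subst hβα
        exact ⟨p v hlead, hf _ _ hβΛ ▸ hfJ ⟨_, hβΛ⟩,
          hlc _ _ hβΛ ▸ (Dvd.intro _ rfl).trans (hdvd ⟨_, hβΛ⟩), hppos v hlead, le_rfl⟩
      · obtain ⟨r, hrJ, hr, hr1⟩ := exists_linear_polynomial hJ.deriv _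
          (hf _ _ hβΛ ▸ hfJ ⟨_, hβΛ⟩)
          (fun h0 => hpd _ (hΛ' _ hβΛ) (h0 ▸ I.zero_mem)) (lt_of_le_of_ne hβ hβα)
        refine ⟨r, hrJ, ?_, by omega, hr1 ▸ hppos v hlead⟩
        rw [hr, ← hsep _ _ hβΛ]
        exact (Dvd.intro_left _ rfl).trans (hdvd ⟨_, hβΛ⟩)
    rw [← hq]
    exact mul_aeval_mem_of_pseudo_division hJI hJ.radical hrJ hrh hrpos
      (fun b hb hlt => ihp b (hpmin v hlead b hb (hlt.trans_le hrmin))) (hq ▸ hg)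
  -- If `v` is not a leader, every initial, and hence every coefficient, lies in `I`; no division is
  -- needed.
  · rw [← hq]
    refine ihp q (coeff_mem_of_forall_leadingCoeff_mem q.natDegree (fun q' hq' _ => ?_) q
      (by rw [show Polynomial.aeval (X v) q = g from hq]; exact hg) le_rfl)
    by_contra hN
    exact hlead ⟨q', hq', hN⟩

/-- The basis theorem of Ritt and Raudenbush. -/
theorem isPerfectFG [Algebra ℚ R] {I : Ideal (DiffPoly R k (X' ⊕ Fin n))}
    (hI : IsPerfect (DiffPoly.deriv R (X' ⊕ Fin n)) (coefficients R k X' n) I) :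
    IsPerfectFG (DiffPoly.deriv R (X' ⊕ Fin n)) (coefficients R k X' n) I :=
  isPerfectFG_of_prime (fun I hp hI => exists_finset_mul_mem_perfectClosure I hp hI) hI

end DiffPoly

end DifferentialAlgebra

namespace DifferentialAlgebra

/-! ### From finite generation to Noetherian spaces -/

section Topology

variable {R A κ : Type*} [CommRing R] [CommRing A] [Algebra R A]
  {δ : κ → Derivation R A A} {W : Set A}

theorem wellFoundedGT_isPerfect (H : ∀ I : Ideal A, IsPerfect δ W I → IsPerfectFG δ W I) :
    WellFoundedGT {I : Ideal A // IsPerfect δ W I} := by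
  rw [wellFoundedGT_iff_monotone_chain_condition]
  intro a
  have hd : Directed (· ≤ ·) (fun i => (a i).1) :=
    (show Monotone fun i => (a i).1 from fun _ _ h => a.monotone h).directed_le
  obtain ⟨T, hT⟩ := H _ (isPerfect_of_directed hd fun i => (a i).2)
  have hTs : ∀ t ∈ T, ∃ i, t ∈ (a i).1 := fun t ht =>
    (Submodule.mem_iSup_of_directed _ hd).1 (hT ▸ subset_perfectClosure _ ht)
  choose! f hf using hTs
  refine ⟨T.sup f, fun m hm => le_antisymm (a.monotone hm) ?_⟩
  have h₁ : ⨆ i, (a i).1 ≤ (a (T.sup f)).1 := by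
    rw [← hT]
    exact perfectClosure_le (a _).2 fun t ht =>
      a.monotone (show f t ≤ T.sup f from Finset.le_sup ht) (hf t ht)
  exact (le_iSup (fun i => (a i).1) m).trans h₁

theorem isPerfect_iInf {ι : Type*} {K : ι → Ideal A} (hK : ∀ i, IsPerfect δ W (K i)) :
    IsPerfect δ W (⨅ i, K i) where
  radical := Ideal.isRadical_iInf _ fun i => (hK i).radical
  deriv j a ha := by
    rw [Submodule.mem_iInf] at ha ⊢
    exact fun i => (hK i).deriv j a (ha i)
  saturated w hw a ha := by
    rw [Submodule.mem_iInf] at ha ⊢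
    exact fun i => (hK i).saturated w hw a (ha i)

/-- A topology generated by closed sets of points that are defined by conditions `s ⊆ K a`, where
the `K a` are prime and perfect, is Noetherian. -/
theorem noetherianSpace_of_isPerfect
    (H : ∀ I : Ideal A, IsPerfect δ W I → IsPerfectFG δ W I) {P : Type*} (K : P → Ideal A)
    (hprime : ∀ a, (K a).IsPrime) (hK : ∀ a, IsPerfect δ W (K a)) (𝒰 : Set (Set P))
    (h𝒰 : ∀ U ∈ 𝒰, ∃ s : Set A, U = {a | s ⊆ K a}ᶜ) :
    @TopologicalSpace.NoetherianSpace P (TopologicalSpace.generateFrom 𝒰) := by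
  let τ : TopologicalSpace P := TopologicalSpace.generateFrom 𝒰
  let pt : P → PrimeSpectrum A := fun a => ⟨K a, hprime a⟩
  -- The topology pulled back from the prime spectrum is finer, so every closed set has the form `{a
  -- | s ⊆ K a}`; finite unions need no separate treatment.
  have hle : TopologicalSpace.induced pt inferInstance ≤ τ := by
    refine le_generateFrom fun U hU => ?_
    obtain ⟨s, rfl⟩ := h𝒰 U hU
    exact ⟨(PrimeSpectrum.zeroLocus s)ᶜ, (PrimeSpectrum.isClosed_zeroLocus s).isOpen_compl, rfl⟩
  have hclosed : ∀ C : TopologicalSpace.Closeds P, ∃ s : Set A, ∀ a, a ∈ C ↔ s ⊆ K a := by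
    intro C
    obtain ⟨Z, hZ, hZC⟩ := (isClosed_induced_iff (f := pt)).1 (C.isClosed.mono hle)
    obtain ⟨s, rfl⟩ := (PrimeSpectrum.isClosed_iff_zeroLocus Z).1 hZ
    refine ⟨s, fun a => ?_⟩
    rw [← SetLike.mem_coe, ← hZC]
    rfl
  obtain ⟨V, hV⟩ : ∃ V : TopologicalSpace.Closeds P → {I : Ideal A // IsPerfect δ W I},
      ∀ C x, x ∈ (V C).1 ↔ ∀ a ∈ C, x ∈ K a :=
    ⟨fun C => ⟨⨅ a : {a // a ∈ C}, K a.1, isPerfect_iInf fun a => hK a.1⟩,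
      fun C x => by simp only [Submodule.mem_iInf, Subtype.forall]⟩
  have hVle : ∀ C C', (V C).1 ≤ (V C').1 → C' ≤ C := by
    intro C C' h a ha
    obtain ⟨s, hs⟩ := hclosed C
    exact (hs a).2 fun x hx => (hV C' x).1 (h ((hV C x).2 fun b hb => (hs b).1 hb hx)) a ha
  have hanti : StrictAnti V := by
    intro C C' h
    refine lt_of_le_of_ne (fun x hx => (hV C x).2 fun a ha => (hV C' x).1 hx a (h.le ha))
      fun heq => h.not_ge (hVle _ _ (le_of_eq ?_))
    rw [heq]
  have := wellFoundedGT_isPerfect H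
  exact ((TopologicalSpace.noetherianSpace_TFAE P).out 0 1).2 hanti.wellFoundedLT

end Topology

/-! ### Differential homomorphisms and zero-testing at polynomials -/

section DiffHom

open MvPolynomial

variable {R : Type u} [CommRing R] {k : ℕ} {Y : Type v} {A : Type w} [CommRing A] [Algebra R A]
  {δ : Fin k → Derivation R A A}

theorem DiffPoly.hom_deriv_of_X {e : DiffPoly R k Y →ₐ[R] A}
    (h : ∀ i v, e (X (shift i v)) = δ i (e (X v))) (i : Fin k) (p : DiffPoly R k Y) :
    e (DiffPoly.deriv R Y i p) = δ i (e p) := by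
  induction p using MvPolynomial.induction_on with
  | C r => rw [← algebraMap_eq, Derivation.map_algebraMap, map_zero, AlgHom.commutes,
      Derivation.map_algebraMap]
  | add p q hp hq => simp only [map_add, hp, hq]
  | mul_X p v hp =>
    simp only [Derivation.leibniz, map_add, map_mul, smul_eq_mul, DiffPoly.deriv_X, hp, h]

theorem exists_iterated_derivation (hδ : ∀ i j a, δ i (δ j a) = δ j (δ i a)) :
    ∃ D : (Fin k →₀ ℕ) → Module.End R A, D 0 = 1 ∧
      ∀ i α a, D (α + Finsupp.single i 1) a = δ i (D α a) := by
  classical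
  let ϕ : ∀ _ : Fin k, Multiplicative ℕ →* Module.End R A := fun i =>
    powersHom (Module.End R A) (δ i : A →ₗ[R] A)
  have hc : Pairwise fun i j => ∀ x y, Commute (ϕ i x) (ϕ j y) := by
    intro i j _ x y
    have : Commute (δ i : Module.End R A) (δ j : Module.End R A) := LinearMap.ext fun a => hδ i j a
    exact this.pow_pow _ _
  let Φ := MonoidHom.noncommPiCoprod ϕ hc
  refine ⟨fun α => Φ fun i => Multiplicative.ofAdd (α i), Φ.map_one, fun i α a => ?_⟩
  have : (fun j => Multiplicative.ofAdd ((α + Finsupp.single i 1 : Fin k →₀ ℕ) j)) =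
      (Pi.mulSingle i (Multiplicative.ofAdd 1) : Fin k → Multiplicative ℕ) *
        fun j => Multiplicative.ofAdd (α j) := by
    funext j
    by_cases h : j = i
    · subst h
      simp [add_comm]
    · simp [h]
  simp only [this, map_mul]
  have h₁ : Φ (Pi.mulSingle i (Multiplicative.ofAdd 1)) = (δ i : A →ₗ[R] A) := by
    rw [MonoidHom.noncommPiCoprod_mulSingle]
    simp [ϕ]
  rw [h₁]
  rfl

/-- The existence half of the universal property: differential polynomials form the free commutative
algebra with `k` commuting derivations. -/
theorem DiffPoly.exists_hom (hδ : ∀ i j a, δ i (δ j a) = δ j (δ i a)) (b : Y → A) :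
    ∃ e : DiffPoly R k Y →ₐ[R] A, (∀ y, e (X (y, 0)) = b y) ∧
      ∀ i p, e (DiffPoly.deriv R Y i p) = δ i (e p) := by
  obtain ⟨D, hD0, hD⟩ := exists_iterated_derivation hδ
  refine ⟨aeval fun v => D v.2 (b v.1), fun y => by simp [hD0], hom_deriv_of_X fun i v => ?_⟩
  rw [aeval_X, aeval_X]
  exact hD i v.2 _

theorem DiffPoly.deriv_comm (i j : Fin k) (p : DiffPoly R k Y) :
    DiffPoly.deriv R Y i (DiffPoly.deriv R Y j p) =
      DiffPoly.deriv R Y j (DiffPoly.deriv R Y i p) := by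
  have : ⁅DiffPoly.deriv R Y i, DiffPoly.deriv R Y j⁆ = 0 := by
    refine MvPolynomial.derivation_ext fun v => ?_
    rw [Derivation.commutator_apply, deriv_X, deriv_X, deriv_X, deriv_X]
    simp [shift, add_assoc, add_comm (Finsupp.single i 1)]
  have h := congrArg (fun D : Derivation R (DiffPoly R k Y) (DiffPoly R k Y) => D p) this
  simpa [Derivation.commutator_apply, sub_eq_zero] using h

theorem DiffPoly.hom_ext {e e' : DiffPoly R k Y →ₐ[R] A}
    (he : ∀ i p, e (DiffPoly.deriv R Y i p) = δ i (e p))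
    (he' : ∀ i p, e' (DiffPoly.deriv R Y i p) = δ i (e' p))
    (h : ∀ y, e (X (y, 0)) = e' (X (y, 0))) : e = e' := by
  refine MvPolynomial.algHom_ext fun ⟨y, α⟩ => ?_
  induction α using finsupp_shift_induction with
  | h0 => exact h y
  | hs i α ih =>
    have := he i (X (y, α))
    rw [ih, ← he', deriv_X] at this
    exact this

theorem pderiv_comm {σ : Type*} (i j : σ) (p : MvPolynomial σ R) :
    pderiv i (pderiv j p) = pderiv j (pderiv i p) := by
  classical
  have : ⁅(pderiv i : Derivation R (MvPolynomial σ R) _), pderiv j⁆ = 0 :=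
    MvPolynomial.derivation_ext fun v => by
      rw [Derivation.commutator_apply, pderiv_X, pderiv_X]
      simp [Pi.single_apply, apply_ite]
  have h := congrArg (fun D : Derivation R (MvPolynomial σ R) _ => D p) this
  simpa [Derivation.commutator_apply, sub_eq_zero] using h

/-- The factor is `(γ + α)! / γ!` in multi-index notation. Only its being nonzero and independent of
`f` matters. -/
theorem coeff_iterated_pderiv (α : Fin k →₀ ℕ) : ∃ N : (Fin k →₀ ℕ) → ℕ, (∀ γ, N γ ≠ 0) ∧
    ∀ f : (Fin k →₀ ℕ) → MvPolynomial (Fin k) R,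
      (∀ i α, f (α + Finsupp.single i 1) = pderiv i (f α)) →
      ∀ γ, coeff γ (f α) = coeff (γ + α) (f 0) * N γ := by
  induction α using finsupp_shift_induction with
  | h0 => exact ⟨fun _ => 1, by simp, fun f _ γ => by simp⟩
  | hs i α ih =>
    obtain ⟨N, hN, h⟩ := ih
    refine ⟨fun γ => N (γ + Finsupp.single i 1) * (γ i + 1),
      fun γ => Nat.mul_ne_zero (hN _) (Nat.succ_ne_zero _), fun f hf γ => ?_⟩
    rw [hf, coeff_pderiv, h f hf]
    push_cast
    rw [add_assoc, add_comm (Finsupp.single i 1) α, mul_assoc]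

/-- A differential polynomial that vanishes at all polynomials is zero. -/
theorem DiffPoly.eq_zero_of_forall_hom [IsDomain R] [Algebra ℚ R] {p : DiffPoly R k Y}
    (h : ∀ e : DiffPoly R k Y →ₐ[R] MvPolynomial (Fin k) R,
      (∀ i q, e (DiffPoly.deriv R Y i q) = pderiv i (e q)) → e p = 0) : p = 0 := by
  classical
  have : CharZero R := algebraRat.charZero R
  have : Infinite R := inferInstance
  choose N hN hNf using coeff_iterated_pderiv (R := R) (k := k)
  refine MvPolynomial.funext fun c => ?_
  -- Taylor polynomials: for each variable `(y, α)` of `p`, the derivative of `b y` of order `α`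
  -- takes the value `c (y, α)` at the origin. So `e p` has constant term `eval c p`.
  let b : Y → MvPolynomial (Fin k) R := fun y => ∑ α ∈ p.vars.image Prod.snd,
    monomial α (c (y, α) * algebraMap ℚ R (N α 0 : ℚ)⁻¹)
  obtain ⟨e, heb, hed⟩ := exists_hom (R := R)
    (δ := fun i : Fin k => (pderiv i : Derivation R (MvPolynomial (Fin k) R) _))
    pderiv_comm b
  have he := h e hed
  have key : constantCoeff (e p) = eval c p := by
    refine hom_congr_vars (f₁ := (constantCoeff : MvPolynomial (Fin k) R →+* R).comp
      (e : DiffPoly R k Y →+* MvPolynomial (Fin k) R)) (f₂ := eval c) ?_ ?_ rfl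
    · refine RingHom.ext fun r => ?_
      simp only [RingHom.comp_apply, RingHom.coe_coe, eval_C]
      rw [← algebraMap_eq, AlgHom.commutes, algebraMap_eq, constantCoeff_C]
    · rintro ⟨y, α⟩ hv -
      have h₁ := hNf α (fun β => e (X (y, β)))
        (fun i β => by rw [← hed, deriv_X]; rfl) 0
      simp only [zero_add, heb] at h₁
      have h₂ : coeff α (b y) = c (y, α) * algebraMap ℚ R (N α 0 : ℚ)⁻¹ := by
        simp only [b, coeff_sum, coeff_monomial]
        rw [Finset.sum_ite_eq', if_pos (Finset.mem_image_of_mem Prod.snd hv)]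
      have h₃ : algebraMap ℚ R (N α 0 : ℚ)⁻¹ * (N α 0 : R) = 1 := by
        rw [← map_natCast (algebraMap ℚ R), ← map_mul,
          inv_mul_cancel₀ (by exact_mod_cast hN α 0), map_one]
      simp only [RingHom.comp_apply, RingHom.coe_coe, constantCoeff_eq, eval_X]
      rw [h₁, h₂, mul_assoc, h₃, mul_one]
  rw [← key, he, map_zero, map_zero]

theorem DiffPoly.eq_of_forall_hom [IsDomain R] [Algebra ℚ R] {p q : DiffPoly R k Y}
    (h : ∀ e : DiffPoly R k Y →ₐ[R] MvPolynomial (Fin k) R,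
      (∀ i q, e (DiffPoly.deriv R Y i q) = pderiv i (e q)) → e p = e q) : p = q :=
  sub_eq_zero.1 (eq_zero_of_forall_hom fun e he => by rw [map_sub, h e he, sub_self])

end DiffHom

end DifferentialAlgebra

namespace UnivAlg

open scoped FirstOrder
open FirstOrder.Language

/-! ### Transfer of identities and generation of free algebras -/

section General

variable {L : FirstOrder.Language.{u, 0}}

/-- An equality of terms in arbitrary variables that holds in `A` also holds in every algebra that
satisfies the identities of `A`. -/
theorem realize_eq_of_inVariety {A : Type w} [L.Structure A] {B : Type w'} [L.Structure B]
    (hB : InVariety (identitiesOf L A) B) {Y : Type v} {s t : L.Term Y}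
    (h : ∀ x : Y → A, s.realize x = t.realize x) (y : Y → B) : s.realize y = t.realize y := by
  classical
  let V : Finset Y := s.varFinset ∪ t.varFinset
  let e := V.equivFin
  have hs : ∀ {a}, a ∈ s.varFinset → a ∈ V := fun h => Finset.mem_union_left _ h
  have ht : ∀ {a}, a ∈ t.varFinset → a ∈ V := fun h => Finset.mem_union_right _ h
  let s' : L.Term ℕ := s.restrictVar fun a => (e ⟨a, hs a.2⟩ : ℕ)
  let t' : L.Term ℕ := t.restrictVar fun a => (e ⟨a, ht a.2⟩ : ℕ)
  have transfer : ∀ {C : Type w} [L.Structure C] (z : ℕ → C) (z' : Y → C),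
      (∀ a : V, z (e a) = z' a) → s'.realize z = s.realize z' ∧ t'.realize z = t.realize z' :=
    fun z z' hz => ⟨Term.realize_restrictVar z' fun a => hz ⟨a, hs a.2⟩,
      Term.realize_restrictVar z' fun a => hz ⟨a, ht a.2⟩⟩
  have transferB : ∀ (z : ℕ → B) (z' : Y → B),
      (∀ a : V, z (e a) = z' a) → s'.realize z = s.realize z' ∧ t'.realize z = t.realize z' :=
    fun z z' hz => ⟨Term.realize_restrictVar z' fun a => hz ⟨a, hs a.2⟩,
      Term.realize_restrictVar z' fun a => hz ⟨a, ht a.2⟩⟩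
  have hid : (s', t') ∈ identitiesOf L A := by
    intro z
    let z' : Y → A := fun a => if ha : a ∈ V then z (e ⟨a, ha⟩) else z 0
    obtain ⟨h₁, h₂⟩ := transfer z z' fun a => by simp [z', a.2]
    exact h₁.trans ((h z').trans h₂.symm)
  rcases isEmpty_or_nonempty V with hV | ⟨⟨a₀⟩⟩
  -- Without variables `y` supplies no element of `B`, but the value of the closed term `s` does.
  · have hB' : Nonempty (ℕ → B) := ⟨fun _ => s.realize y⟩
    obtain ⟨z⟩ := hB'
    obtain ⟨h₁, h₂⟩ := transferB z y fun a => hV.elim a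
    exact h₁.symm.trans ((hB _ hid z).trans h₂)
  · let z : ℕ → B := fun l => if hl : l < V.card then y (e.symm ⟨l, hl⟩) else y a₀
    obtain ⟨h₁, h₂⟩ := transferB z y fun a => by simp [z]
    exact h₁.symm.trans ((hB _ hid z).trans h₂)

theorem inVariety_substructure {E : Set (Identity L)} {A : Type w} [L.Structure A]
    (hA : InVariety E A) (S : L.Substructure A) : InVariety E S := by
  intro e he x
  apply S.subtype.injective
  rw [← HomClass.realize_term, ← HomClass.realize_term]
  exact hA e he _

/-- A free algebra is generated by its free generators. -/
theorem IsFree.exists_term {E : Set (Identity L)} {X : Type v} {F : Type w} [L.Structure F]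
    {ι : X → F} (hF : IsFree E ι) (a : F) : ∃ t : L.Term X, t.realize ι = a := by
  let S := Substructure.closure L (Set.range ι)
  obtain ⟨φ, hφ, -⟩ := hF.existsUnique_hom S (inVariety_substructure hF.inVariety S)
    fun x => ⟨ι x, Substructure.subset_closure ⟨x, rfl⟩⟩
  obtain ⟨ψ, -, hψ⟩ := hF.existsUnique_hom F hF.inVariety ι
  -- By uniqueness, the map to the generated subalgebra followed by the inclusion is the identity,
  -- so that subalgebra is everything.
  have h : S.subtype.toHom.comp φ = FirstOrder.Language.Hom.id L F :=
    (hψ _ fun x => by simp [hφ]).trans (hψ _ fun _ => rfl).symm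
  have ha : a ∈ S := by
    have := congrArg (fun χ : F →[L] F => χ a) h
    simp only [FirstOrder.Language.Hom.comp_apply, FirstOrder.Language.Hom.id_apply] at this
    rw [← this]
    exact (φ a).2
  obtain ⟨t, ht⟩ := Substructure.mem_closure_iff_exists_term.1 ha
  refine ⟨t.relabel fun r => r.2.choose, ?_⟩
  rw [Term.realize_relabel, ← ht]
  congr 1
  funext r
  exact r.2.choose_spec

/-- Homomorphisms from a coproduct are determined by the two restrictions. -/
theorem Coprod.hom_ext [L.IsAlgebraic] {E : Set (Identity L)} {A : Type w} {X : Type v}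
    [L.Structure A] {C : Type w'} [L.Structure C] {φ ψ : Coprod E A (FreeAlg E X) →[L] C}
    (hl : ∀ a, φ (Coprod.inl a) = ψ (Coprod.inl a))
    (hr : ∀ x, φ (Coprod.inr (FreeAlg.gen E x)) = ψ (Coprod.inr (FreeAlg.gen E x))) : φ = ψ := by
  have h : φ.comp Coprod.inr = ψ.comp (Coprod.inr (A := A)) := Presented.hom_ext hr
  refine Presented.hom_ext fun y => ?_
  rcases y with a | g
  · exact hl a
  · exact congrArg (fun χ : FreeAlg E X →[L] C => χ g) h

end General

/-! ### Embedding free algebras into differential polynomials -/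

section Poisson

open DifferentialAlgebra

variable {R : Type u} [CommRing R] {m : ℕ}

/-- A commutative algebra with derivations `δ₁, …, δ₂ₘ`, as an algebra with the bracket
`∑ᵢ (δ₂ᵢ₋₁ f δ₂ᵢ g - δ₂ᵢ f δ₂ᵢ₋₁ g)`. -/
def DerivationPoisson {A : Type v} [CommRing A] [Algebra R A]
    (_ : Fin (2 * m) → Derivation R A A) : Type v :=
  A

/-- The operations given by derivations. -/
noncomputable def DerivationPoisson.op {A : Type v} [CommRing A] [Algebra R A]
    (δ : Fin (2 * m) → Derivation R A A) :
    {b : Bool} → {k : ℕ} → PoissonOp R b k → (Fin k → A) → A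
  | _, _, .zero, _ => 0
  | _, _, .one, _ => 1
  | _, _, .neg, x => -x 0
  | _, _, .smul r, x => r • x 0
  | _, _, .add, x => x 0 + x 1
  | _, _, .mul, x => x 0 * x 1
  | _, _, .bracket, x => ∑ i : Fin m,
    (δ ⟨2 * i.1, by omega⟩ (x 0) * δ ⟨2 * i.1 + 1, by omega⟩ (x 1) -
      δ ⟨2 * i.1 + 1, by omega⟩ (x 0) * δ ⟨2 * i.1, by omega⟩ (x 1))

noncomputable instance {A : Type v} [CommRing A] [Algebra R A]
    (δ : Fin (2 * m) → Derivation R A A) (b : Bool) :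
    (poissonLang R b).Structure (DerivationPoisson δ) where
  funMap f x := DerivationPoisson.op (A := A) δ f x
  RelMap ρ := ρ.elim

variable {A : Type v} [CommRing A] [Algebra R A] {B : Type w} [CommRing B] [Algebra R B]
  {δ : Fin (2 * m) → Derivation R A A} {δ' : Fin (2 * m) → Derivation R B B}

theorem DerivationPoisson.map_op (e : A →ₐ[R] B) (he : ∀ i a, e (δ i a) = δ' i (e a)) {b : Bool}
    {k : ℕ} (f : PoissonOp R b k) (x : Fin k → A) : e (op δ f x) = op δ' f (e ∘ x) := by
  cases f <;> simp [op, he]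

/-- A homomorphism of algebras with derivations respects the operations. -/
noncomputable def DerivationPoisson.hom (b : Bool) (e : A →ₐ[R] B)
    (he : ∀ i a, e (δ i a) = δ' i (e a)) :
    DerivationPoisson δ →[poissonLang R b] DerivationPoisson δ' where
  toFun := e
  map_fun' f x := DerivationPoisson.map_op e he f x
  map_rel' ρ := ρ.elim

/-- The symplectic Poisson algebra is given by the partial derivations. -/
noncomputable def DerivationPoisson.toSymplectic (R : Type u) [CommRing R] (m : ℕ) (b : Bool) :
    DerivationPoisson (fun i : Fin (2 * m) =>
      (MvPolynomial.pderiv i : Derivation R (MvPolynomial (Fin (2 * m)) R) _))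
      →[poissonLang R b] SymplecticPoisson R m where
  toFun := id
  map_fun' f x := by cases f <;> rfl
  map_rel' ρ := ρ.elim

/-- The ring of differential polynomials, with the bracket given by its derivations. -/
abbrev DiffPoisson (R : Type u) [CommRing R] (m : ℕ) (Y : Type v) : Type (max u v) :=
  DerivationPoisson (DiffPoly.deriv R (k := 2 * m) Y)

/-- The indeterminates. -/
noncomputable def DiffPoisson.gen {Y : Type v} (y : Y) : DiffPoisson R m Y :=
  (MvPolynomial.X (y, 0) : DiffPoly R (2 * m) Y)

/-- Each differential homomorphism to `R[x₁, …, x₂ₘ]` is a homomorphism to `Pₘ`, where the two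
values agree; such homomorphisms separate differential polynomials. -/
theorem DiffPoisson.realize_gen_eq [IsDomain R] [Algebra ℚ R] {b : Bool} {Y : Type w}
    {s t : (poissonLang R b).Term Y}
    (h : ∀ x : Y → SymplecticPoisson R m, s.realize x = t.realize x) :
    s.realize (gen : Y → DiffPoisson R m Y) = t.realize gen := by
  refine DiffPoly.eq_of_forall_hom (R := R) (k := 2 * m) (Y := Y) fun e he => ?_
  let Φ := (DerivationPoisson.toSymplectic R m b).comp
    (DerivationPoisson.hom (δ := DiffPoly.deriv R Y) b e he)
  have := h (Φ ∘ gen)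
  rw [HomClass.realize_term, HomClass.realize_term] at this
  exact this

/-- The indeterminates are generic: any assignment is their image under a differential homomorphism.
-/
theorem DiffPoisson.realize_eq {b : Bool} {Y : Type w'} {s t : (poissonLang R b).Term Y}
    (h : s.realize (gen : Y → DiffPoisson R m Y) = t.realize gen)
    (hδ : ∀ i j a, δ i (δ j a) = δ j (δ i a)) (x : Y → DerivationPoisson δ) :
    s.realize x = t.realize x := by
  obtain ⟨e, he, hed⟩ := DiffPoly.exists_hom hδ x
  let Φ := DerivationPoisson.hom (δ := DiffPoly.deriv R Y) b e hed
  have hx : x = Φ ∘ gen := funext fun y => (he y).symm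
  rw [hx, HomClass.realize_term, HomClass.realize_term, h]

/-- Algebras given by commuting derivations belong to the variety generated by `Pₘ`. -/
theorem DerivationPoisson.inVariety [IsDomain R] [Algebra ℚ R] (b : Bool)
    (hδ : ∀ i j a, δ i (δ j a) = δ j (δ i a)) :
    InVariety (identitiesOf (poissonLang R b) (SymplecticPoisson R m)) (DerivationPoisson δ) :=
  fun _ he x => DiffPoisson.realize_eq (DiffPoisson.realize_gen_eq he) hδ x

theorem DiffPoisson.inVariety [IsDomain R] [Algebra ℚ R] (b : Bool) (Y : Type w) :
    InVariety (identitiesOf (poissonLang R b) (SymplecticPoisson R m)) (DiffPoisson R m Y) :=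
  DerivationPoisson.inVariety b DiffPoly.deriv_comm

/-- The free algebras of the variety generated by `Pₘ` embed into rings of differential
polynomials. -/
theorem IsFree.exists_injective_hom [IsDomain R] [Algebra ℚ R] {b : Bool} {X : Type v}
    {F : Type (max u v w)} [(poissonLang R b).Structure F] {ι : X → F}
    (hF : IsFree (identitiesOf (poissonLang R b) (SymplecticPoisson R m)) ι) :
    ∃ φ : F →[poissonLang R b] DiffPoisson R m (ULift.{w} X), Function.Injective φ := by
  obtain ⟨φ, hφ, -⟩ := hF.existsUnique_hom (DiffPoisson R m (ULift.{w} X))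
    (DiffPoisson.inVariety b _) fun x => DiffPoisson.gen ⟨x⟩
  refine ⟨φ, fun a a' h => ?_⟩
  obtain ⟨s, rfl⟩ := hF.exists_term a
  obtain ⟨t, rfl⟩ := hF.exists_term a'
  rw [← HomClass.realize_term, ← HomClass.realize_term] at h
  have hg : (φ ∘ ι) = (DiffPoisson.gen : ULift.{w} X → DiffPoisson R m _) ∘ ULift.up :=
    funext hφ
  rw [hg, ← Term.realize_relabel, ← Term.realize_relabel] at h
  -- An equality at the indeterminates holds in `Pₘ`, whose derivations commute; it is therefore an
  -- identity of the variety and holds at `ι`.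
  have key : ∀ x : ULift.{w} X → SymplecticPoisson R m,
      (s.relabel ULift.up).realize x = (t.relabel ULift.up).realize x := by
    intro x
    let x' : ULift.{w} X → DerivationPoisson (fun i : Fin (2 * m) =>
      (MvPolynomial.pderiv i : Derivation R (MvPolynomial (Fin (2 * m)) R) _)) := x
    have hx := congrArg (DerivationPoisson.toSymplectic R m b)
      (DiffPoisson.realize_eq h pderiv_comm x')
    rwa [← HomClass.realize_term, ← HomClass.realize_term] at hx
  have := realize_eq_of_inVariety hF.inVariety key (ι ∘ ULift.down)
  rwa [Term.realize_relabel, Term.realize_relabel] at this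

end Poisson

end UnivAlg

namespace UnivAlg

open scoped FirstOrder
open FirstOrder.Language

/-! ### Equations over `F` as differential polynomials -/

section Final

open DifferentialAlgebra

variable {R : Type u} [CommRing R] {m : ℕ}

/-- The inclusion of the coefficients into the differential polynomials in further
indeterminates. -/
theorem exists_coefficient_hom (R : Type u) [CommRing R] (k : ℕ) (Y : Type v) (n : ℕ) :
    ∃ e : DiffPoly R k Y →ₐ[R] DiffPoly R k (Y ⊕ Fin n),
      (∀ i p, e (DiffPoly.deriv R Y i p) = DiffPoly.deriv R _ i (e p)) ∧
      (∀ y, e (MvPolynomial.X (y, 0)) = MvPolynomial.X (Sum.inl y, 0)) ∧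
      ∀ w ∈ coefficients R k Y n, ∃ p, e p = w := by
  refine ⟨MvPolynomial.rename (Prod.map Sum.inl id), ?_, ?_, ?_⟩
  · refine DiffPoly.hom_deriv_of_X fun i v => ?_
    rw [MvPolynomial.rename_X, MvPolynomial.rename_X, DiffPoly.deriv_X]
    rfl
  · intro y
    rw [MvPolynomial.rename_X]
    rfl
  · rintro w ⟨hw, -⟩
    have : MvPolynomial.supported R {v : (Y ⊕ Fin n) × (Fin k →₀ ℕ) | rank v = ⊥} ≤
        (MvPolynomial.rename (R := R) (Prod.map (Sum.inl : Y → Y ⊕ Fin n)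
          (id : (Fin k →₀ ℕ) → _))).range := by
      refine Algebra.adjoin_le ?_
      rintro _ ⟨⟨y | j, α⟩, hv, rfl⟩
      · exact ⟨MvPolynomial.X (y, α), MvPolynomial.rename_X _ _⟩
      · exact absurd hv.out (WithBot.coe_ne_bot)
    exact this hw

/-- A point corresponds to the kernel of its evaluation map on `R{Y ⊕ Fin n}`. By injectivity of
`φ`, a point solves an equation exactly when the associated differential polynomial lies in that
kernel. -/
theorem equationallyNoetherian_of_injective_hom [IsDomain R] [Algebra ℚ R] {b : Bool}
    {F : Type w} [(poissonLang R b).Structure F]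
    (hF : InVariety (identitiesOf (poissonLang R b) (SymplecticPoisson R m)) F) {Y : Type v}
    (φ : F →[poissonLang R b] DiffPoisson R m Y) (hφ : Function.Injective φ) :
    EquationallyNoetherian (L := poissonLang R b) PoissonOp.zero hF := by
  intro n
  obtain ⟨j, hj, hjX, hjc⟩ := exists_coefficient_hom R (2 * m) Y n
  have hev : ∀ a : Fin n → F, ∃ e : DiffPoly R (2 * m) (Y ⊕ Fin n) →ₐ[R] DiffPoly R (2 * m) Y,
      (∀ y, e (MvPolynomial.X (y, 0)) = Sum.elim DiffPoisson.gen (φ ∘ a) y) ∧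
        ∀ i p, e (DiffPoly.deriv R _ i p) = DiffPoly.deriv R _ i (e p) := fun a =>
    DiffPoly.exists_hom DiffPoly.deriv_comm _
  choose ev hevX hevd using hev
  have hevj : ∀ a p, ev a (j p) = p := fun a p => by
    have : (ev a).comp j = AlgHom.id R _ :=
      DiffPoly.hom_ext (δ := DiffPoly.deriv R Y) (fun i p => by simp [hj, hevd])
        (fun i p => rfl) fun y => by
          rw [AlgHom.comp_apply, hjX, hevX]
          rfl
    exact congrArg (fun χ : DiffPoly R (2 * m) Y →ₐ[R] DiffPoly R (2 * m) Y => χ p) this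
  let poly : Coprod (identitiesOf (poissonLang R b) (SymplecticPoisson R m)) F
      (FreeAlg (identitiesOf (poissonLang R b) (SymplecticPoisson R m)) (Fin n))
      →[poissonLang R b] DiffPoisson R m (Y ⊕ Fin n) :=
    Coprod.desc (DiffPoisson.inVariety b _)
      ((DerivationPoisson.hom (δ := DiffPoly.deriv R Y) b j hj).comp φ)
      (FreeAlg.lift (DiffPoisson.inVariety b _) fun i => DiffPoisson.gen (Sum.inr i))
  -- Both sides are homomorphisms in `f` that agree on `F` and on the unknowns.
  have hpoly : ∀ a f, ev a (poly f) = φ (eval hF f a) := by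
    intro a f
    have : (DerivationPoisson.hom (δ := DiffPoly.deriv R (Y ⊕ Fin n))
          (δ' := DiffPoly.deriv R Y) b (ev a) (hevd a)).comp poly =
        φ.comp (Coprod.desc hF (Hom.id _ F) (FreeAlg.lift hF a)) :=
      Coprod.hom_ext (fun c => hevj a (φ c)) fun i => hevX a (Sum.inr i)
    exact congrArg (fun χ : _ →[poissonLang R b] DiffPoisson R m Y => χ f) this
  let z : (poissonLang R b).Constants := PoissonOp.zero
  have hφ0 : φ (z : F) = (0 : DiffPoly R (2 * m) Y) := φ.map_constants z
  refine noetherianSpace_of_isPerfect (δ := DiffPoly.deriv R (Y ⊕ Fin n))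
    (W := coefficients R (2 * m) Y n) (fun I hI => isPerfectFG hI)
    (fun a => RingHom.ker (ev a)) (fun a => RingHom.ker_isPrime _) (fun a => ⟨?_, ?_, ?_⟩) _ ?_
  · exact (RingHom.ker_isPrime _).isRadical
  · intro i p hp
    rw [RingHom.mem_ker] at hp ⊢
    rw [hevd, hp, map_zero]
  · intro w hw p hp
    rw [RingHom.mem_ker, map_mul] at hp
    -- A nonzero coefficient is the image under `j` of an element that `ev a` recovers, so its value
    -- is nonzero.
    refine (mul_eq_zero.1 hp).resolve_left fun h0 => hw.2 ?_
    obtain ⟨q, rfl⟩ := hjc w hw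
    rw [hevj] at h0
    rw [h0, map_zero]
  · rintro _ ⟨S, rfl⟩
    refine ⟨poly '' S, congrArg _ (Set.ext fun a => ?_)⟩
    refine Iff.trans ?_ (Set.image_subset_iff (f := poly)).symm
    refine forall₂_congr fun f _ => ?_
    change eval hF f a = (z : F) ↔ ev a (poly f) = 0
    rw [hpoly, ← hφ0]
    exact hφ.eq_iff.symm

end Final

end UnivAlg

theorem corollary8 {R : Type u} [CommRing R] [IsDomain R] [Algebra ℚ R]
    (hR : UnivAlg.RadicallyNoetherian R) (m : ℕ) (unital : Bool)
    {X : Type v} {F : Type (max u v w)} [(UnivAlg.poissonLang R unital).Structure F] (ι : X → F)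
    (hF : UnivAlg.IsFree
      (UnivAlg.identitiesOf (UnivAlg.poissonLang R unital) (UnivAlg.SymplecticPoisson R m)) ι) :
    UnivAlg.EquationallyNoetherian (L := UnivAlg.poissonLang R unital)
      UnivAlg.PoissonOp.zero hF.inVariety := by
  obtain ⟨φ, hφ⟩ := hF.exists_injective_hom
  exact UnivAlg.equationallyNoetherian_of_injective_hom hF.inVariety φ hφ
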